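/- Let $p$ be a prime, $n\ge 1$, and equip $\mathbb{Q}_p^n$ with $|x|_p=\max_j|x_j|_p$ and with the Haar measure $|\cdot|_h$ normalized so that the closed unit ball has measure $1$. For $\gamma\in\mathbb{Z}$ let $B_\gamma(x)=\{y:|y-x|_p\le p^\gamma\}$. For measurable $f$ put $$\mathcal{M}^p(f)(x)=\sup_{\gamma\in\mathbb{Z}}\frac1{|B_\gamma(x)|_h}\int_{B_\gamma(x)}|f(y)|\,dy ,\qquad \mathcal{M}^p_{B}(f)(x)=\sup_{\gamma:\,B_\gamma(x)\subset B}\frac1{|B_\gamma(x)|_h}\int_{B_\gamma(x)}|f(y)|\,dy$$ for a ball $B$, and $[b,\mathcal{M}^p](f)=b\,\mathcal{M}^p(f)-\mathcal{M}^p(bf)$. Let $q_-(E)$ and $q_+(E)$ be the essential infimum and supremum of $q(\cdot)$ over $E$, and $q_\pm=q_\pm(\mathbb{Q}_p^n)$. Let $\mathscr{P}$ be the set of measurable $q(\cdot):\mathbb{Q}_p^n\to(1,\infty)$ with $1<q_-\le q(x)\le q_+<\infty$ for all $x$, and $\mathscr{C}^{\log}$ the set of $q(\cdot)\in\mathscr{P}$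 for which there is a constant $C>0$ with $$\gamma\bigl(q_-(B_\gamma(x))-q_+(B_\gamma(x))\bigr)\le C\quad\text{and}\quad |q(x)-q(y)|\le\frac{C}{\log_p(p+\min\{|x|_p,|y|_p\})}$$ for all $\gamma\in\mathbb{Z}$ and $x,y\in\mathbb{Q}_p^n$. For $q(\cdot)\in\mathscr{P}$, $L^{q(\cdot)}$ is the space of measurable $f$ with $\int|f(x)/\eta|^{q(x)}dx<\infty$ for some $\eta>0$, with the norm $\|f\|_{L^{q(\cdot)}}=\inf\{\eta>0:\int|f(x)/\eta|^{q(x)}dx\le1\}$. For $0<\beta<1$, $\Lambda_\beta$ is the space of measurable real-valued $f$ with $\sup_{x\ne y}|f(x)-f(y)|/|x-y|_p^\beta<\infty$. Let $0<\beta<1$ and let $b$ be a locally integrable real-valued function on $\mathbb{Q}_p^n$. Call $(r(\cdot),q(\cdot))$ an admissible pair if $r(\cdot),q(\cdot)\in\mathscr{C}^{\log}$, $r_+<n/\beta$, and $1/q(\cdot)=1/r(\cdot)-\beta/n$. The following statements are equivalent: (1) $b\in\Lambda_\beta$ and $b\ge0$, that is, $b$ agrees almost everywhere with a nonnegative function in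 $\Lambda_\beta$. (2) $[b,\mathcal{M}^p]$ is bounded from $L^{r(\cdot)}$ to $L^{q(\cdot)}$ for every admissible pair, that is, for each such pair there is a constant $C$ such that, for every $f\in L^{r(\cdot)}$, the function $[b,\mathcal{M}^p](f)$ is well defined and finite almost everywhere, lies in $L^{q(\cdot)}$, and satisfies $\|[b,\mathcal{M}^p](f)\|_{L^{q(\cdot)}}\le C\|f\|_{L^{r(\cdot)}}$. (3) $[b,\mathcal{M}^p]$ is bounded from $L^{r(\cdot)}$ to $L^{q(\cdot)}$ for some admissible pair. (4) For some admissible pair, $$\sup_{\gamma\in\mathbb{Z},\,x\in\mathbb{Q}_p^n}\frac1{|B_\gamma(x)|_h^{\beta/n}}\,\frac{\bigl\|\bigl(b-\mathcal{M}^p_{B_\gamma(x)}(b)\bigr)\chi_{B_\gamma(x)}\bigr\|_{L^{q(\cdot)}}}{\|\chi_{B_\gamma(x)}\|_{L^{q(\cdot)}}}<\infty .$$ (5) The inequality in (4) holds for every admissible pair. -/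

import Mathlib

open MeasureTheory Metric
open scoped NNReal ENNReal

noncomputable section

namespace PadicLip

/-- The Borel sigma-algebra of the field of `p`-adic numbers. -/
instance instMeasurableSpacePadic (p : ℕ) [Fact p.Prime] : MeasurableSpace ℚ_[p] := borel ℚ_[p]

instance instBorelSpacePadic (p : ℕ) [Fact p.Prime] : BorelSpace ℚ_[p] := ⟨rfl⟩

/-- The space of `n`-tuples of `p`-adic numbers; its norm is the maximum of the `p`-adic absolute
values of the coordinates. -/
abbrev Space (p : ℕ) [Fact p.Prime] (n : ℕ) : Type := Fin n → ℚ_[p]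

variable {p : ℕ} [Fact p.Prime] {n : ℕ}

/-- The closed unit ball, as a compact set with non-empty interior. -/
def unitBall (p : ℕ) [Fact p.Prime] (n : ℕ) : TopologicalSpace.PositiveCompacts (Space p n) where
  carrier := closedBall 0 1
  isCompact' := isCompact_closedBall 0 1
  interior_nonempty' :=
    ⟨0, ball_subset_interior_closedBall (mem_ball_self one_pos)⟩

/-- The Haar measure, normalized so that the closed unit ball has measure one. -/
def haar (p : ℕ) [Fact p.Prime] (n : ℕ) : Measure (Space p n) :=
  Measure.addHaarMeasure (unitBall p n)

/-- The ball `B_γ(x)`: centre `x`, radius `p ^ γ`. -/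
def pBall (γ : ℤ) (x : Space p n) : Set (Space p n) := closedBall x ((p : ℝ) ^ γ)

/-! ### Maximal functions and the nonlinear commutator -/

/-- The mean of `|f|` over `B_γ(x)`, with values in `[0, ∞]`. -/
def avgAbs (f : Space p n → ℝ) (γ : ℤ) (x : Space p n) : ℝ≥0∞ :=
  (haar p n (pBall γ x))⁻¹ * ∫⁻ y in pBall γ x, ‖f y‖ₑ ∂haar p n

/-- The Hardy-Littlewood maximal function. -/
def maximal (f : Space p n → ℝ) (x : Space p n) : ℝ≥0∞ :=
  ⨆ γ : ℤ, avgAbs f γ x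

/-- The maximal function relative to a fixed ball `B`: only the balls inside `B` are used. -/
def maximalIn (B : Set (Space p n)) (f : Space p n → ℝ) (x : Space p n) : ℝ≥0∞ :=
  ⨆ (γ : ℤ) (_ : pBall γ x ⊆ B), avgAbs f γ x

/-- The nonlinear commutator `[b, M] f = b M f - M (b f)`, as an extended real number. In `EReal`
the difference `∞ - ∞` is `-∞`, so a point at which the commutator is not a well-defined real
number because `M (b f)` is infinite counts as a point at which it is infinite. -/
def commutator (b f : Space p n → ℝ) (x : Space p n) : EReal :=
  (b x : EReal) * (maximal f x : EReal) - (maximal (fun y => b y * f y) x : EReal)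

/-! ### Variable exponents -/

/-- `q_-(E)`, the essential infimum of `q` over `E`. -/
def expInf (q : Space p n → ℝ) (E : Set (Space p n)) : ℝ := essInf q ((haar p n).restrict E)

/-- `q_+(E)`, the essential supremum of `q` over `E`. -/
def expSup (q : Space p n → ℝ) (E : Set (Space p n)) : ℝ := essSup q ((haar p n).restrict E)

/-- The class of measurable exponents with `1 < q_- ≤ q(x) ≤ q_+ < ∞` for all `x`. Boundedness is
stated separately, so that `q_-` and `q_+` are the true essential bounds. -/
structure IsExponent (q : Space p n → ℝ) : Prop where
  measurable : Measurable q
  one_lt_inf : 1 < expInf q Set.univ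
  inf_le : ∀ x, expInf q Set.univ ≤ q x
  le_sup : ∀ x, q x ≤ expSup q Set.univ
  bounded : ∃ K : ℝ, ∀ x, |q x| ≤ K

/-- Global log-Hölder continuity: the local condition on balls together with the decay condition
at infinity. -/
structure IsLogHolder (q : Space p n → ℝ) : Prop where
  isExponent : IsExponent q
  local_bound : ∃ C : ℝ, 0 < C ∧ ∀ (γ : ℤ) (x : Space p n),
    (γ : ℝ) * (expInf q (pBall γ x) - expSup q (pBall γ x)) ≤ C
  decay : ∃ C : ℝ, 0 < C ∧ ∀ x y : Space p n,
    |q x - q y| ≤ C / Real.logb p (p + min ‖x‖ ‖y‖)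

/-- The pairs of exponents `r, q` with `r_+ < n / β` and `1 / q = 1 / r - β / n`. -/
structure IsAdmissiblePair (β : ℝ) (r q : Space p n → ℝ) : Prop where
  left : IsLogHolder r
  right : IsLogHolder q
  sup_lt : expSup r Set.univ < n / β
  eq : ∀ x, 1 / q x = 1 / r x - β / n

/-! ### Variable exponent Lebesgue spaces -/

/-- The modular `∫ |f(x) / η| ^ q(x) dx` of `f / η`. -/
def modular (q : Space p n → ℝ) (f : Space p n → EReal) (η : ℝ≥0) : ℝ≥0∞ :=
  ∫⁻ x, ((f x).abs / (η : ℝ≥0∞)) ^ q x ∂haar p n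

/-- The Luxemburg norm, infinite if no `η` is admissible. -/
def luxNorm (q : Space p n → ℝ) (f : Space p n → EReal) : ℝ≥0∞ :=
  ⨅ (η : ℝ≥0) (_ : 0 < η ∧ modular q f η ≤ 1), (η : ℝ≥0∞)

/-- Membership in the variable exponent Lebesgue space. Such a function is finite almost
everywhere. -/
def MemVarLp (q : Space p n → ℝ) (f : Space p n → EReal) : Prop :=
  AEMeasurable f (haar p n) ∧ ∃ η : ℝ≥0, 0 < η ∧ modular q f η < ∞

/-- The commutator `[b, M]` is bounded from the space with exponent `r` to the one with
exponent `q`. -/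
def CommutatorBounded (b : Space p n → ℝ) (r q : Space p n → ℝ) : Prop :=
  ∃ C : ℝ≥0, ∀ f : Space p n → ℝ, MemVarLp r (fun x => (f x : EReal)) →
    MemVarLp q (commutator b f) ∧
      luxNorm q (commutator b f) ≤ C * luxNorm r (fun x => (f x : EReal))

/-- The supremum over all balls `B` of
`|B| ^ (-β / n) * ‖(b - M_B b) χ_B‖ / ‖χ_B‖`, the norms being those with exponent `q`. -/
def oscillation (β : ℝ) (b : Space p n → ℝ) (q : Space p n → ℝ) : ℝ≥0∞ :=
  ⨆ (γ : ℤ) (x : Space p n),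
    (1 / haar p n (pBall γ x) ^ (β / n)) *
      (luxNorm q ((pBall γ x).indicator
          fun y => (b y : EReal) - (maximalIn (pBall γ x) b y : EReal)) /
        luxNorm q ((pBall γ x).indicator fun _ => (1 : EReal)))

/-! ### The Lipschitz space -/

/-- The homogeneous Lipschitz norm of order `β`. -/
def lipNorm (β : ℝ) (f : Space p n → ℝ) : ℝ≥0∞ :=
  ⨆ (x : Space p n) (y : Space p n) (_ : x ≠ y), ENNReal.ofReal (|f x - f y| / ‖x - y‖ ^ β)

/-- Membership in the homogeneous Lipschitz space of order `β`. -/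
def MemLip (β : ℝ) (f : Space p n → ℝ) : Prop :=
  Measurable f ∧ lipNorm β f < ∞

end PadicLip

end

noncomputable section

namespace PadicLip

variable {p : ℕ} [Fact p.Prime] {n : ℕ}

/-! Two balls are nested or disjoint, and a ball of radius `p ^ γ` has measure `p ^ (n γ)`, so
`radius ^ β = |B| ^ (β / n)`. Averages at scale `γ` are constant on balls of radius `p ^ γ`. These
facts replace every covering argument.

Lipschitz to bounded commutator. If `b ≥ 0` is Lipschitz, then on `B_γ(x)` the values of `b` differ
from `b x` by at most `L |B| ^ (β / n)`. Hence `b x` times the average of `|f|` and the average of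
`b |f|` differ by at most `L |B| ^ (β / n)` times the average of `|f|`. Taking suprema gives `|[b,
M] f| ≤ L M_{β/n} f` with the fractional maximal function (`abs_commutator_le`). What remains is
that `M_α` maps `L^r` to `L^q` when `1/q = 1/r - α` (`exists_luxEnn_fracMax_le`). A function of
modular at most one is split at height 1. On balls of radius at most 1, local log-Hölder continuity
freezes the exponent for the large part, and the constant exponent maximal theorem applies.
Everything else is dominated by a function bounded by 2 and lying in `L^R`, where `R` is the limit
of `r` at infinity. For it Hedberg's inequality applies, and the decay condition allows the limit
`Q` of `q` to be exchanged for `q` at the cost of an integrable weight.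

Bounded commutator to oscillation. For `f = χ_B` the commutator equals `b - M_B b` on `B`, and
Hölder's inequality gives `‖χ_B‖_r ≤ 2 |B| ^ (β / n) ‖χ_B‖_q`.

Oscillation to Lipschitz. Boundedness of `M` on `L^q` turns the norm condition into `avg_B |b - M_B
b| ≤ K |B| ^ (β / n)`. Since `M_B b` is at least the mean of `|b|` over `B`, this bounds both the
mean oscillation of `b` and the gap between the means of `|b|` and `b` (`mean_bounds`). Campanato's
argument produces the Lipschitz representative. Letting the radius tend to zero gives `|b| ≤ b`
almost everywhere, hence the sign. -/

/-! ### Ultrametric geometry and Haar measure of balls. -/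

lemma one_lt_prime_real (p : ℕ) [Fact p.Prime] : (1 : ℝ) < p := by
  exact_mod_cast (Fact.out : p.Prime).one_lt

lemma prime_real_pos (p : ℕ) [Fact p.Prime] : (0 : ℝ) < p :=
  one_pos.trans (one_lt_prime_real p)

lemma radius_pos (γ : ℤ) : (0 : ℝ) < (p : ℝ) ^ γ := zpow_pos (prime_real_pos p) γ

instance instIsAddHaarMeasureHaar : (haar p n).IsAddHaarMeasure := by
  unfold haar; infer_instance

lemma isOpen_pBall (γ : ℤ) (x : Space p n) : IsOpen (pBall γ x) :=
  IsUltrametricDist.isOpen_closedBall x (radius_pos γ).ne'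

lemma measurableSet_pBall (γ : ℤ) (x : Space p n) : MeasurableSet (pBall γ x) :=
  measurableSet_closedBall

lemma mem_pBall_self (γ : ℤ) (x : Space p n) : x ∈ pBall γ x :=
  mem_closedBall_self (radius_pos γ).le

lemma mem_pBall_comm {γ : ℤ} {x y : Space p n} : y ∈ pBall γ x ↔ x ∈ pBall γ y := by
  simp only [pBall, mem_closedBall, dist_comm]

lemma pBall_eq_of_mem {γ : ℤ} {x y : Space p n} (h : y ∈ pBall γ x) : pBall γ x = pBall γ y :=
  IsUltrametricDist.closedBall_eq_of_mem h

lemma pBall_mono {γ δ : ℤ} (h : γ ≤ δ) (x : Space p n) : pBall γ x ⊆ pBall δ x :=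
  closedBall_subset_closedBall (zpow_le_zpow_right₀ (one_lt_prime_real p).le h)

lemma pBall_subset_of_mem {γ δ : ℤ} (h : γ ≤ δ) {x y : Space p n} (hy : y ∈ pBall δ x) :
    pBall γ y ⊆ pBall δ x := by
  rw [pBall_eq_of_mem hy]; exact pBall_mono h y

/-- A digit splits off one power of `p`. -/
lemma exists_digit (γ : ℤ) (x : ℚ_[p]) (hx : ‖x‖ ≤ (p : ℝ) ^ (γ + 1)) :
    ∃ a : Fin p, ‖x - (p : ℚ_[p]) ^ (-(γ + 1)) * (a : ℕ)‖ ≤ (p : ℝ) ^ γ := by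
  have hp0 : (p : ℚ_[p]) ≠ 0 := by exact_mod_cast (Fact.out : p.Prime).ne_zero
  have hpr := prime_real_pos p
  -- Rescaling puts the point in `ℤ_p`, where the digit is the residue modulo `p`.
  set y : ℚ_[p] := (p : ℚ_[p]) ^ (γ + 1) * x with hy
  have hy1 : ‖y‖ ≤ 1 := by
    rw [hy, norm_mul, Padic.norm_p_zpow]
    calc (p : ℝ) ^ (-(γ + 1)) * ‖x‖ ≤ (p : ℝ) ^ (-(γ + 1)) * (p : ℝ) ^ (γ + 1) := by gcongr
      _ = 1 := by rw [← zpow_add₀ hpr.ne']; simp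
  obtain ⟨z, hz⟩ : ∃ z : ℤ_[p], (z : ℚ_[p]) = y := ⟨⟨y, hy1⟩, rfl⟩
  obtain ⟨a, ha, ham⟩ := PadicInt.exists_mem_range (p := p) z
  refine ⟨⟨a, ha⟩, ?_⟩
  have h1 : ‖y - (a : ℕ)‖ ≤ (p : ℝ) ^ (-1 : ℤ) := by
    rw [PadicInt.maximalIdeal_eq_span_p, ← pow_one (p : ℤ_[p]),
      ← PadicInt.norm_le_pow_iff_mem_span_pow] at ham
    rw [PadicInt.norm_def, PadicInt.coe_sub, PadicInt.coe_natCast, hz] at ham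
    exact ham
  have h2 : x - (p : ℚ_[p]) ^ (-(γ + 1)) * (a : ℕ) = (p : ℚ_[p]) ^ (-(γ + 1)) * (y - (a : ℕ)) := by
    rw [hy, mul_sub, ← mul_assoc, ← zpow_add₀ hp0]; simp
  simp only [h2, norm_mul, Padic.norm_p_zpow]
  calc (p : ℝ) ^ (- -(γ + 1)) * ‖y - (a : ℕ)‖ ≤ (p : ℝ) ^ (- -(γ + 1)) * (p : ℝ) ^ (-1 : ℤ) := by
        gcongr
    _ = (p : ℝ) ^ γ := by rw [← zpow_add₀ hpr.ne']; congr 1; ring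

/-- The ultrametric inequality makes `a - b` divisible by `p`, while `|a - b| < p`. -/
lemma digit_injective (γ : ℤ) {a b : Fin p} (x : ℚ_[p])
    (ha : ‖x - (p : ℚ_[p]) ^ (-(γ + 1)) * (a : ℕ)‖ ≤ (p : ℝ) ^ γ)
    (hb : ‖x - (p : ℚ_[p]) ^ (-(γ + 1)) * (b : ℕ)‖ ≤ (p : ℝ) ^ γ) : a = b := by
  have hpr := prime_real_pos p
  have h1 : ‖(p : ℚ_[p]) ^ (-(γ + 1)) * (((a : ℕ) : ℤ) - ((b : ℕ) : ℤ) : ℤ)‖ ≤ (p : ℝ) ^ γ := by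
    have := (IsUltrametricDist.norm_add_le_max (x - (p : ℚ_[p]) ^ (-(γ + 1)) * (b : ℕ))
      (-(x - (p : ℚ_[p]) ^ (-(γ + 1)) * (a : ℕ)))).trans (max_le hb (by rwa [norm_neg]))
    refine le_of_eq_of_le (congrArg _ ?_) this
    push_cast; ring
  rw [norm_mul, Padic.norm_p_zpow] at h1
  have h2 : ‖((((a : ℕ) : ℤ) - ((b : ℕ) : ℤ) : ℤ) : ℚ_[p])‖ < 1 := by
    have h3 : ‖((((a : ℕ) : ℤ) - ((b : ℕ) : ℤ) : ℤ) : ℚ_[p])‖ ≤ (p : ℝ) ^ (-1 : ℤ) := by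
      have : (p : ℝ) ^ γ = (p : ℝ) ^ (- -(γ + 1)) * (p : ℝ) ^ (-1 : ℤ) := by
        rw [← zpow_add₀ hpr.ne']; congr 1; ring
      rw [this] at h1
      exact le_of_mul_le_mul_left h1 (zpow_pos hpr _)
    refine h3.trans_lt ?_
    rw [zpow_neg_one]; exact inv_lt_one_of_one_lt₀ (one_lt_prime_real p)
  rw [Padic.norm_intCast_lt_one_iff] at h2
  have h4 := Int.eq_zero_of_abs_lt_dvd h2 (by have := a.2; have := b.2; rw [abs_lt]; omega)
  exact Fin.ext (by omega)

lemma haar_pBall_center (γ : ℤ) (x : Space p n) :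
    haar p n (pBall γ x) = haar p n (pBall γ 0) := by
  have : pBall γ x = (fun y => (-x) + y) ⁻¹' pBall γ 0 := by
    ext y; simp [pBall, dist_eq_norm, sub_eq_neg_add]
  rw [this, measure_preimage_add]

/-- Choosing one digit per coordinate cuts the larger ball into `p ^ n` disjoint translates of the
smaller one. -/
lemma haar_pBall_succ (γ : ℤ) :
    haar p n (pBall (γ + 1) 0) = (p : ℝ≥0∞) ^ n * haar p n (pBall γ 0) := by
  let c : (Fin n → Fin p) → Space p n := fun a i => (p : ℚ_[p]) ^ (-(γ + 1)) * ((a i : ℕ) : ℚ_[p])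
  have hU : pBall (γ + 1) (0 : Space p n) = ⋃ a : Fin n → Fin p, pBall γ (c a) := by
    apply Set.Subset.antisymm
    · intro x hx
      have hx' : ∀ i, ‖x i‖ ≤ (p : ℝ) ^ (γ + 1) := by
        intro i
        have : ‖x‖ ≤ (p : ℝ) ^ (γ + 1) := by simpa [pBall] using hx
        exact (norm_le_pi_norm x i).trans this
      choose a ha using fun i => exists_digit γ (x i) (hx' i)
      refine Set.mem_iUnion.2 ⟨a, ?_⟩
      rw [pBall, mem_closedBall, dist_eq_norm, pi_norm_le_iff_of_nonneg (radius_pos γ).le]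
      exact ha
    · refine Set.iUnion_subset fun a => pBall_subset_of_mem (by omega) ?_
      rw [pBall, mem_closedBall, dist_eq_norm, pi_norm_le_iff_of_nonneg (radius_pos _).le]
      intro i
      simp only [c, Pi.sub_apply, Pi.zero_apply, sub_zero, norm_mul, Padic.norm_p_zpow, neg_neg]
      have : ‖((a i : ℕ) : ℚ_[p])‖ ≤ 1 := mod_cast Padic.norm_int_le_one (p := p) ((a i : ℕ) : ℤ)
      simpa using mul_le_mul_of_nonneg_left this (radius_pos (p := p) (γ + 1)).le
  have hd : Pairwise (Function.onFun Disjoint fun a : Fin n → Fin p => pBall γ (c a)) := by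
    intro a b hab
    refine Set.disjoint_left.2 fun x hxa hxb => hab ?_
    simp only [pBall, mem_closedBall, dist_eq_norm,
      pi_norm_le_iff_of_nonneg (radius_pos γ).le] at hxa hxb
    exact funext fun i => digit_injective γ (x i) (hxa i) (hxb i)
  rw [hU, measure_iUnion hd fun a => measurableSet_pBall γ _]
  simp [haar_pBall_center γ, tsum_fintype]

/-- The measure of a ball. -/
theorem haar_pBall (γ : ℤ) (x : Space p n) :
    haar p n (pBall γ x) = (p : ℝ≥0∞) ^ ((n : ℝ) * γ) := by
  have hp0 : (p : ℝ≥0∞) ≠ 0 := by exact_mod_cast (Fact.out : p.Prime).ne_zero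
  have hpt : (p : ℝ≥0∞) ≠ ∞ := ENNReal.natCast_ne_top p
  have hs : ∀ γ : ℤ, (p : ℝ≥0∞) ^ ((n : ℝ) * ((γ + 1 : ℤ) : ℝ)) =
      (p : ℝ≥0∞) ^ n * (p : ℝ≥0∞) ^ ((n : ℝ) * γ) := by
    intro γ
    rw [← ENNReal.rpow_natCast, ← ENNReal.rpow_add _ _ hp0 hpt]; congr 1; push_cast; ring
  rw [haar_pBall_center]
  induction γ with
  | zero =>
    have : pBall 0 (0 : Space p n) = (unitBall p n : Set (Space p n)) := by
      simp [pBall, unitBall]; rfl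
    rw [this, haar, Measure.addHaarMeasure_self]; simp
  | succ i ih => rw [haar_pBall_succ, ih, hs]
  | pred i ih =>
    have h1 := haar_pBall_succ (p := p) (n := n) (-(i : ℤ) - 1)
    rw [sub_add_cancel, ih] at h1
    have h2 := hs (-(i : ℤ) - 1)
    rw [sub_add_cancel] at h2
    rw [h2] at h1
    exact ((ENNReal.mul_right_inj (pow_ne_zero _ hp0) (ENNReal.pow_ne_top hpt)).1 h1).symm

/-! ### Volumes and averages -/

/-- The measure of a ball of radius `p ^ γ`. -/
def vol (p n : ℕ) (γ : ℤ) : ℝ≥0∞ := (p : ℝ≥0∞) ^ ((n : ℝ) * γ)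

lemma prime_ne_zero (p : ℕ) [Fact p.Prime] : (p : ℝ≥0∞) ≠ 0 := by
  exact_mod_cast (Fact.out : p.Prime).ne_zero

lemma one_lt_prime (p : ℕ) [Fact p.Prime] : (1 : ℝ≥0∞) < p := by
  exact_mod_cast (Fact.out : p.Prime).one_lt

lemma prime_ne_top (p : ℕ) : (p : ℝ≥0∞) ≠ ∞ := ENNReal.natCast_ne_top p

lemma haar_pBall_eq_vol (γ : ℤ) (x : Space p n) : haar p n (pBall γ x) = vol p n γ :=
  haar_pBall γ x

lemma vol_ne_zero (p : ℕ) [Fact p.Prime] (n : ℕ) (γ : ℤ) : vol p n γ ≠ 0 :=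
  (ENNReal.rpow_pos (pos_iff_ne_zero.2 (prime_ne_zero p)) (prime_ne_top p)).ne'

lemma vol_ne_top (p : ℕ) [Fact p.Prime] (n : ℕ) (γ : ℤ) : vol p n γ ≠ ∞ :=
  ENNReal.rpow_ne_top_of_ne_zero (prime_ne_zero p) (prime_ne_top p)

lemma vol_mono (p : ℕ) [Fact p.Prime] (n : ℕ) {γ δ : ℤ} (h : γ ≤ δ) : vol p n γ ≤ vol p n δ :=
  ENNReal.rpow_le_rpow_of_exponent_le (one_lt_prime p).le
    (mul_le_mul_of_nonneg_left (by exact_mod_cast h) n.cast_nonneg)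

lemma vol_le_one (p : ℕ) [Fact p.Prime] (n : ℕ) {γ : ℤ} (h : γ ≤ 0) : vol p n γ ≤ 1 := by
  simpa [vol] using vol_mono p n h

lemma one_le_vol (p : ℕ) [Fact p.Prime] (n : ℕ) {γ : ℤ} (h : 0 ≤ γ) : 1 ≤ vol p n γ := by
  simpa [vol] using vol_mono p n h

lemma vol_rpow (p n : ℕ) (γ : ℤ) (t : ℝ) : vol p n γ ^ t = (p : ℝ≥0∞) ^ ((n : ℝ) * γ * t) := by
  rw [vol, ← ENNReal.rpow_mul]

/-- The mean of a nonnegative function over a ball. -/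
def avg (F : Space p n → ℝ≥0∞) (γ : ℤ) (x : Space p n) : ℝ≥0∞ :=
  (haar p n (pBall γ x))⁻¹ * ∫⁻ y in pBall γ x, F y ∂haar p n

lemma avg_eq (F : Space p n → ℝ≥0∞) (γ : ℤ) (x : Space p n) :
    avg F γ x = (vol p n γ)⁻¹ * ∫⁻ y in pBall γ x, F y ∂haar p n := by
  rw [avg, haar_pBall_eq_vol]

lemma avg_eq_of_mem (F : Space p n → ℝ≥0∞) {γ : ℤ} {x y : Space p n} (h : y ∈ pBall γ x) :
    avg F γ y = avg F γ x := by
  rw [avg, avg, pBall_eq_of_mem h]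

lemma measurable_of_const_on_pBall {β : Type*} [TopologicalSpace β] [MeasurableSpace β]
    [BorelSpace β] {g : Space p n → β} (γ : ℤ)
    (h : ∀ x, ∀ y ∈ pBall γ x, g y = g x) : Measurable g := by
  refine (IsLocallyConstant.continuous ?_).measurable
  rw [IsLocallyConstant.iff_exists_open]
  exact fun x => ⟨pBall γ x, isOpen_pBall γ x, mem_pBall_self γ x, h x⟩

lemma measurable_avg (F : Space p n → ℝ≥0∞) (γ : ℤ) : Measurable (avg F γ) :=
  measurable_of_const_on_pBall γ fun _ _ h => avg_eq_of_mem F h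

lemma avg_mono_on {F G : Space p n → ℝ≥0∞} {γ : ℤ} {x : Space p n}
    (h : ∀ᵐ y ∂haar p n, y ∈ pBall γ x → F y ≤ G y) : avg F γ x ≤ avg G γ x := by
  unfold avg
  gcongr 1
  exact setLIntegral_mono_ae' (measurableSet_pBall γ x) h

lemma avg_mono {F G : Space p n → ℝ≥0∞} (h : ∀ y, F y ≤ G y) (γ : ℤ) (x : Space p n) :
    avg F γ x ≤ avg G γ x := avg_mono_on (.of_forall fun y _ => h y)

lemma avg_congr_ae {F G : Space p n → ℝ≥0∞} (h : F =ᵐ[haar p n] G) (γ : ℤ) (x : Space p n) :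
    avg F γ x = avg G γ x :=
  (avg_mono_on (h.mono fun _ h _ => h.le)).antisymm (avg_mono_on (h.mono fun _ h _ => h.ge))

lemma avg_const (c : ℝ≥0∞) (γ : ℤ) (x : Space p n) : avg (fun _ => c) γ x = c := by
  rw [avg_eq, setLIntegral_const, haar_pBall_eq_vol, mul_comm, mul_assoc,
    ENNReal.mul_inv_cancel (vol_ne_zero p n γ) (vol_ne_top p n γ), mul_one]

lemma avg_le_of_le {F : Space p n → ℝ≥0∞} {c : ℝ≥0∞} {γ : ℤ} {x : Space p n}
    (h : ∀ᵐ y ∂haar p n, y ∈ pBall γ x → F y ≤ c) : avg F γ x ≤ c :=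
  (avg_mono_on h).trans (avg_const c γ x).le

lemma avg_add {F : Space p n → ℝ≥0∞} (hF : AEMeasurable F (haar p n)) (G : Space p n → ℝ≥0∞)
    (γ : ℤ) (x : Space p n) : avg (fun y => F y + G y) γ x = avg F γ x + avg G γ x := by
  rw [avg, avg, avg, lintegral_add_left' hF.restrict, mul_add]

lemma avg_const_mul {F : Space p n → ℝ≥0∞} {c : ℝ≥0∞} (hc : c ≠ ∞)
    (γ : ℤ) (x : Space p n) : avg (fun y => c * F y) γ x = c * avg F γ x := by
  rw [avg, avg, lintegral_const_mul' _ _ hc, mul_left_comm]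

lemma avg_le_vol_inv_mul (F : Space p n → ℝ≥0∞) (γ : ℤ) (x : Space p n) :
    avg F γ x ≤ (vol p n γ)⁻¹ * ∫⁻ y, F y ∂haar p n := by
  rw [avg_eq]; gcongr; exact Measure.restrict_le_self

/-- Jensen's inequality, obtained from Hölder's inequality against the constant 1. -/
lemma avg_rpow_le {F : Space p n → ℝ≥0∞} (hF : AEMeasurable F (haar p n)) {t : ℝ} (ht : 1 ≤ t)
    (γ : ℤ) (x : Space p n) : avg F γ x ^ t ≤ avg (fun y => F y ^ t) γ x := by
  rcases ht.eq_or_lt with rfl | ht1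
  · simp
  have h0 : 0 < t := one_pos.trans ht1
  have hc := Real.HolderConjugate.conjExponent ht1
  have hV := vol_ne_zero p n γ
  have hV' := vol_ne_top p n γ
  have h1 := ENNReal.lintegral_mul_le_Lp_mul_Lq ((haar p n).restrict (pBall γ x)) hc
    hF.restrict (g := fun _ => 1) aemeasurable_const
  simp only [Pi.mul_apply, mul_one, ENNReal.one_rpow, lintegral_const, one_mul,
    Measure.restrict_apply MeasurableSet.univ, Set.univ_inter, haar_pBall_eq_vol] at h1
  rw [avg_eq, avg_eq]
  calc ((vol p n γ)⁻¹ * ∫⁻ y in pBall γ x, F y ∂haar p n) ^ t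
      ≤ ((vol p n γ)⁻¹ * ((∫⁻ y in pBall γ x, F y ^ t ∂haar p n) ^ (1 / t) *
        vol p n γ ^ (1 / t.conjExponent))) ^ t := by gcongr
    _ = (vol p n γ)⁻¹ * ∫⁻ y in pBall γ x, F y ^ t ∂haar p n := by
      rw [ENNReal.mul_rpow_of_nonneg _ _ h0.le, ENNReal.mul_rpow_of_nonneg _ _ h0.le,
        ← ENNReal.rpow_mul, ← ENNReal.rpow_mul, one_div_mul_cancel h0.ne', ENNReal.rpow_one,
        mul_comm (∫⁻ y in pBall γ x, F y ^ t ∂haar p n), ← mul_assoc, ENNReal.inv_rpow,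
        ← ENNReal.rpow_neg, ← ENNReal.rpow_add _ _ hV hV', ← ENNReal.rpow_neg_one]
      congr 2
      have := hc.inv_add_inv_eq_one
      have h3 : 1 / t.conjExponent = 1 - t⁻¹ := by rw [one_div]; linarith
      rw [h3]; field_simp; ring

/-- Averaging is self-adjoint: it preserves integrals over unions of balls of its radius. -/
lemma setLIntegral_avg {F : Space p n → ℝ≥0∞} (hF : AEMeasurable F (haar p n)) {γ : ℤ}
    {A : Set (Space p n)} (hA : ∀ x ∈ A, pBall γ x ⊆ A) :
    ∫⁻ x in A, avg F γ x ∂haar p n = ∫⁻ x in A, F x ∂haar p n := by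
  have hAo : IsOpen A := isOpen_iff_forall_mem_open.2 fun x hx =>
    ⟨pBall γ x, hA x hx, isOpen_pBall γ x, mem_pBall_self γ x⟩
  have hAm := hAo.measurableSet
  -- The relation `y ∈ B_γ(x)` is symmetric, so after Tonelli each `F y` is counted with weight
  -- `|B_γ(y) ∩ A|`, which is `|B_γ|` or 0.
  let E : Set (Space p n × Space p n) := {z | z.2 ∈ pBall γ z.1}
  have hE : MeasurableSet E :=
    (isClosed_le (continuous_snd.dist continuous_fst) continuous_const).measurableSet
  simp_rw [avg_eq]
  rw [lintegral_const_mul' _ _ (ENNReal.inv_ne_top.2 (vol_ne_zero p n γ))]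
  have h1 : ∀ x, ∫⁻ y in pBall γ x, F y ∂haar p n
      = ∫⁻ y, E.indicator (fun z => F z.2) (x, y) ∂haar p n := by
    intro x
    rw [← lintegral_indicator (measurableSet_pBall γ x)]
    rfl
  simp_rw [h1]
  rw [lintegral_lintegral_swap]
  · have h2 : ∀ y, ∫⁻ x in A, E.indicator (fun z => F z.2) (x, y) ∂haar p n
        = A.indicator (fun y => vol p n γ * F y) y := by
      intro y
      have h3 : ∀ x, E.indicator (fun z => F z.2) (x, y) =
          (pBall γ y).indicator (fun _ => F y) x := by
        intro x
        by_cases hx : x ∈ pBall γ y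
        · rw [Set.indicator_of_mem hx, Set.indicator_of_mem (show (x, y) ∈ E from mem_pBall_comm.1 hx)]
        · rw [Set.indicator_of_notMem hx,
            Set.indicator_of_notMem (show (x, y) ∉ E from fun h => hx (mem_pBall_comm.1 h))]
      simp_rw [h3]
      rw [lintegral_indicator (measurableSet_pBall γ y), setLIntegral_const,
        Measure.restrict_apply (measurableSet_pBall γ y)]
      by_cases hy : y ∈ A
      · rw [Set.indicator_of_mem hy, Set.inter_eq_left.2 (hA y hy), haar_pBall_eq_vol, mul_comm]
      · have : pBall γ y ∩ A = ∅ := by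
          refine Set.eq_empty_of_forall_notMem fun x hx => hy ?_
          exact hA x hx.2 (mem_pBall_comm.1 hx.1)
        rw [Set.indicator_of_notMem hy, this]; simp
    simp_rw [h2]
    rw [lintegral_indicator hAm, lintegral_const_mul' _ _ (vol_ne_top p n γ), ← mul_assoc,
      ENNReal.inv_mul_cancel (vol_ne_zero p n γ) (vol_ne_top p n γ), one_mul]
  · exact (AEMeasurable.comp_quasiMeasurePreserving hF
      Measure.quasiMeasurePreserving_snd).indicator hE |>.mono_ac
      (Measure.AbsolutelyContinuous.prod Measure.restrict_le_self.absolutelyContinuous .rfl)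

/-! ### Maximal functions of nonnegative functions -/

/-- The Hardy-Littlewood maximal function of a nonnegative function. -/
def maxFn (F : Space p n → ℝ≥0∞) (x : Space p n) : ℝ≥0∞ := ⨆ γ : ℤ, avg F γ x

/-- The fractional maximal function of a nonnegative function. -/
def fracMax (α : ℝ) (F : Space p n → ℝ≥0∞) (x : Space p n) : ℝ≥0∞ :=
  ⨆ γ : ℤ, vol p n γ ^ α * avg F γ x

lemma fracMax_zero (F : Space p n → ℝ≥0∞) : fracMax 0 F = maxFn F := by
  ext x; simp [fracMax, maxFn]

lemma avg_le_maxFn (F : Space p n → ℝ≥0∞) (γ : ℤ) (x : Space p n) : avg F γ x ≤ maxFn F x :=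
  le_iSup (fun γ => avg F γ x) γ

lemma le_fracMax (α : ℝ) (F : Space p n → ℝ≥0∞) (γ : ℤ) (x : Space p n) :
    vol p n γ ^ α * avg F γ x ≤ fracMax α F x :=
  le_iSup (fun γ => vol p n γ ^ α * avg F γ x) γ

lemma measurable_maxFn (F : Space p n → ℝ≥0∞) : Measurable (maxFn F) :=
  Measurable.iSup fun γ => measurable_avg F γ

lemma measurable_fracMax (α : ℝ) (F : Space p n → ℝ≥0∞) : Measurable (fracMax α F) :=
  Measurable.iSup fun γ => (measurable_avg F γ).const_mul _

lemma fracMax_congr_ae {F G : Space p n → ℝ≥0∞} (h : F =ᵐ[haar p n] G) (α : ℝ) :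
    fracMax α F = fracMax α G := by
  ext x; simp only [fracMax, avg_congr_ae h]

lemma fracMax_const_mul {F : Space p n → ℝ≥0∞} {c : ℝ≥0∞} (hc : c ≠ ∞) (α : ℝ)
    (x : Space p n) : fracMax α (fun y => c * F y) x = c * fracMax α F x := by
  simp only [fracMax, avg_const_mul hc, ENNReal.mul_iSup]
  simp only [mul_left_comm]

/-- The weak type estimate for the maximal function. -/
theorem mul_haar_lt_maxFn_le {F : Space p n → ℝ≥0∞} (hF : AEMeasurable F (haar p n)) (t : ℝ≥0∞) :
    t * haar p n {x | t < maxFn F x} ≤ ∫⁻ x, F x ∂haar p n := by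
  let T : ℕ → Set (Space p n) := fun N => {x | ∃ γ : ℤ, γ ≤ N ∧ t < avg F γ x}
  have hT : ∀ N, t * haar p n (T N) ≤ ∫⁻ x, F x ∂haar p n := by
    intro N
    -- Points are sorted by the largest scale `γ ≤ N` whose average exceeds `t`; the cap `N` ensures
    -- that it exists. Averages at scales at least `γ` are constant on balls of radius `p ^ γ`, so
    -- each piece is a union of such balls and averaging preserves its integral.
    let A : ℤ → Set (Space p n) := fun γ =>
      {x | γ ≤ N ∧ t < avg F γ x ∧ ∀ δ : ℤ, γ < δ → δ ≤ N → avg F δ x ≤ t}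
    have hAb : ∀ γ, ∀ x ∈ A γ, pBall γ x ⊆ A γ := by
      rintro γ x ⟨h1, h2, h3⟩ y hy
      refine ⟨h1, (avg_eq_of_mem F hy).symm ▸ h2, fun δ hδ hδN => ?_⟩
      rw [avg_eq_of_mem F (pBall_mono hδ.le x hy)]
      exact h3 δ hδ hδN
    have hAm : ∀ γ, MeasurableSet (A γ) := fun γ =>
      (isOpen_iff_forall_mem_open.2 fun x hx =>
        ⟨pBall γ x, hAb γ x hx, isOpen_pBall γ x, mem_pBall_self γ x⟩).measurableSet
    have hAd : Pairwise (Function.onFun Disjoint A) := by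
      intro γ δ hne
      refine Set.disjoint_left.2 ?_
      rintro x ⟨h1, h2, h3⟩ ⟨h4, h5, h6⟩
      rcases hne.lt_or_gt with h | h
      · exact absurd (h3 δ h h4) (not_le.2 h5)
      · exact absurd (h6 γ h h1) (not_le.2 h2)
    have hTA : T N = ⋃ γ, A γ := by
      ext x
      simp only [T, Set.mem_ofPred_eq, Set.mem_iUnion]
      constructor
      · rintro ⟨γ, hγ⟩
        obtain ⟨δ, hδ, hmax⟩ := Int.exists_greatest_of_bdd
          (P := fun γ : ℤ => γ ≤ N ∧ t < avg F γ x) ⟨N, fun z hz => hz.1⟩ ⟨γ, hγ⟩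
        exact ⟨δ, hδ.1, hδ.2, fun ε h1 h2 => not_lt.1 fun h3 => absurd (hmax ε ⟨h2, h3⟩) (by omega)⟩
      · rintro ⟨γ, h⟩
        exact ⟨γ, h.1, h.2.1⟩
    rw [hTA, measure_iUnion hAd hAm, ← ENNReal.tsum_mul_left]
    calc ∑' γ, t * haar p n (A γ) ≤ ∑' γ, ∫⁻ x in A γ, F x ∂haar p n := by
          refine ENNReal.tsum_le_tsum fun γ => ?_
          rw [← setLIntegral_avg hF (hAb γ), ← setLIntegral_const]
          exact setLIntegral_mono' (hAm γ) fun x hx => hx.2.1.le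
      _ = ∫⁻ x in ⋃ γ, A γ, F x ∂haar p n := (lintegral_iUnion hAm hAd _).symm
      _ ≤ ∫⁻ x, F x ∂haar p n := setLIntegral_le_lintegral _ _
  have hU : {x | t < maxFn F x} = ⋃ N, T N := by
    ext x
    simp only [maxFn, lt_iSup_iff, Set.mem_ofPred_eq, Set.mem_iUnion, T]
    constructor
    · rintro ⟨γ, h⟩
      exact ⟨γ.toNat, γ, Int.self_le_toNat γ, h⟩
    · rintro ⟨N, γ, -, h⟩
      exact ⟨γ, h⟩
  have hmono : Monotone T := by
    rintro N M h x ⟨γ, h1, h2⟩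
    exact ⟨γ, h1.trans (by exact_mod_cast h), h2⟩
  rw [hU, hmono.measure_iUnion, ENNReal.mul_iSup]
  exact iSup_le hT

/-- The single term with `2 ^ k < a ≤ 2 ^ (k + 1)` suffices; for `a = ∞` infinitely many terms are
at least 1. -/
lemma rpow_le_tsum_dyadic {s : ℝ} (hs : 0 < s) (a : ℝ≥0∞) :
    a ^ s ≤ ∑' k : ℤ, (2 : ℝ≥0∞) ^ (s * (k + 1)) * (if (2 : ℝ≥0∞) ^ (k : ℝ) < a then 1 else 0) := by
  rcases eq_or_ne a 0 with rfl | ha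
  · simp [hs]
  rcases eq_or_ne a ∞ with rfl | hat
  · have h2 : ∀ k : ℕ, (1 : ℝ≥0∞) ≤ (2 : ℝ≥0∞) ^ (s * ((k : ℤ) + 1)) *
        (if (2 : ℝ≥0∞) ^ (((k : ℤ)) : ℝ) < ∞ then 1 else 0) := by
      intro k
      rw [if_pos (by simp [lt_top_iff_ne_top]), mul_one]
      exact ENNReal.one_le_rpow (by norm_num) (by push_cast; positivity)
    calc (∞ : ℝ≥0∞) ^ s ≤ ∑' _ : ℕ, (1 : ℝ≥0∞) := by
          rw [ENNReal.tsum_const_eq_top_of_ne_zero one_ne_zero]; exact le_top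
      _ ≤ ∑' k : ℕ, (2 : ℝ≥0∞) ^ (s * ((k : ℤ) + 1)) *
        (if (2 : ℝ≥0∞) ^ (((k : ℤ)) : ℝ) < ∞ then 1 else 0) := ENNReal.tsum_le_tsum h2
      _ ≤ _ := ENNReal.tsum_comp_le_tsum_of_injective (f := ((↑) : ℕ → ℤ)) Nat.cast_injective
        (fun k : ℤ => (2 : ℝ≥0∞) ^ (s * (k + 1)) * (if (2 : ℝ≥0∞) ^ (k : ℝ) < ∞ then 1 else 0))
  obtain ⟨k, hk1, hk2⟩ := ENNReal.exists_mem_Ioc_zpow ha hat (y := 2) (by norm_num) (by norm_num)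
  refine le_trans ?_ (ENNReal.le_tsum k)
  rw [← ENNReal.rpow_intCast] at hk1 hk2
  rw [if_pos hk1, mul_one]
  calc a ^ s ≤ ((2 : ℝ≥0∞) ^ ((k + 1 : ℤ) : ℝ)) ^ s := by gcongr
    _ = _ := by rw [← ENNReal.rpow_mul]; congr 1; push_cast; ring

/-- If `2 ^ j < a ≤ 2 ^ (j + 1)`, only the indices `k ≤ j + 1` survive, and they form a geometric
series descending from the top one. -/
lemma tsum_dyadic_le {u : ℝ} (hu : 0 < u) {a : ℝ≥0∞} (ha : a ≠ 0) (hat : a ≠ ∞) :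
    ∑' k : ℤ, (2 : ℝ≥0∞) ^ (u * k) * (if (2 : ℝ≥0∞) ^ ((k : ℝ) - 1) < a then 1 else 0) ≤
      (2 : ℝ≥0∞) ^ (2 * u) * (1 - (2 : ℝ≥0∞) ^ (-u))⁻¹ * a ^ u := by
  obtain ⟨j, hj1, hj2⟩ := ENNReal.exists_mem_Ioc_zpow ha hat (y := 2) (by norm_num) (by norm_num)
  rw [← ENNReal.rpow_intCast] at hj1 hj2
  have h2t : (2 : ℝ≥0∞) ≠ ∞ := by norm_num
  let f : ℤ → ℝ≥0∞ := fun k =>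
    (2 : ℝ≥0∞) ^ (u * k) * (if (2 : ℝ≥0∞) ^ ((k : ℝ) - 1) < a then 1 else 0)
  have h1 : ∑' k : ℤ, f k = ∑' i : ℤ, f (j + 1 - i) := ((Equiv.subLeft (j + 1)).tsum_eq f).symm
  have h2 : ∑' i : ℤ, f (j + 1 - i) ≤ ∑' i : ℕ, (2 : ℝ≥0∞) ^ (u * (j + 1)) * ((2 : ℝ≥0∞) ^ (-u)) ^ i := by
    rw [tsum_of_nat_of_neg_add_one ENNReal.summable ENNReal.summable]
    have h3 : ∀ i : ℕ, f (j + 1 - -((i : ℤ) + 1)) = 0 := by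
      intro i
      simp only [f]
      rw [if_neg, mul_zero]
      rw [not_lt]
      refine hj2.trans (ENNReal.rpow_le_rpow_of_exponent_le (by norm_num) ?_)
      push_cast
      have : (0 : ℝ) ≤ i := i.cast_nonneg
      linarith
    simp_rw [h3]
    rw [tsum_zero, add_zero]
    refine ENNReal.tsum_le_tsum fun i => ?_
    rw [← ENNReal.rpow_natCast, ← ENNReal.rpow_mul, ← ENNReal.rpow_add _ _ (by norm_num) h2t]
    calc f (j + 1 - i) ≤ (2 : ℝ≥0∞) ^ (u * ((j + 1 - i : ℤ) : ℝ)) * 1 := by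
          simp only [f]; gcongr; split_ifs <;> simp
      _ = _ := by rw [mul_one]; congr 1; push_cast; ring
  refine (h1.trans_le h2).trans ?_
  rw [ENNReal.tsum_mul_left, ENNReal.tsum_geometric]
  calc (2 : ℝ≥0∞) ^ (u * (j + 1)) * (1 - (2 : ℝ≥0∞) ^ (-u))⁻¹
      = ((2 : ℝ≥0∞) ^ u * ((2 : ℝ≥0∞) ^ (j : ℝ)) ^ u) * (1 - (2 : ℝ≥0∞) ^ (-u))⁻¹ := by
        rw [← ENNReal.rpow_mul, ← ENNReal.rpow_add _ _ (by norm_num) h2t]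
        congr 2; ring
    _ ≤ ((2 : ℝ≥0∞) ^ (2 * u) * a ^ u) * (1 - (2 : ℝ≥0∞) ^ (-u))⁻¹ := by
        gcongr
        · norm_num
        · linarith
    _ = _ := by ring

/-- The part of `F` that stays below `c` adds at most `c` to any average. -/
lemma lt_maxFn_indicator {F : Space p n → ℝ≥0∞} (hF : Measurable F) {c : ℝ≥0∞}
    {x : Space p n} (h : 2 * c < maxFn F x) : c < maxFn ({y | c < F y}.indicator F) x := by
  by_contra! hle
  refine absurd h (not_lt.2 (iSup_le fun γ => ?_))
  have hm : MeasurableSet {y | c < F y} := measurableSet_lt measurable_const hF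
  calc avg F γ x ≤ avg (fun y => {y | c < F y}.indicator F y + c) γ x := by
        refine avg_mono (fun y => ?_) γ x
        by_cases hy : c < F y
        · rw [Set.indicator_of_mem (show y ∈ {y | c < F y} from hy)]; exact le_self_add
        · exact (not_lt.1 hy).trans le_add_self
    _ = avg ({y | c < F y}.indicator F) γ x + c := by
        rw [avg_add (hF.indicator hm).aemeasurable, avg_const]
    _ ≤ c + c := by gcongr; exact (avg_le_maxFn _ γ x).trans hle
    _ = 2 * c := (two_mul c).symm

/-- The strong type estimate for the maximal function. -/
theorem exists_lintegral_maxFn_rpow_le (p : ℕ) [Fact p.Prime] (n : ℕ) {s : ℝ} (hs : 1 < s) :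
    ∃ C : ℝ≥0∞, C ≠ ∞ ∧ ∀ F : Space p n → ℝ≥0∞, Measurable F →
      ∫⁻ x, maxFn F x ^ s ∂haar p n ≤ C * ∫⁻ x, F x ^ s ∂haar p n := by
  have h2t : (2 : ℝ≥0∞) ≠ ∞ := by norm_num
  have h20 : (2 : ℝ≥0∞) ≠ 0 := by norm_num
  set u := s - 1 with hu
  have hu0 : 0 < u := by rw [hu]; linarith
  set K : ℝ≥0∞ := (2 : ℝ≥0∞) ^ (s + 1) * ((2 : ℝ≥0∞) ^ (2 * u) * (1 - (2 : ℝ≥0∞) ^ (-u))⁻¹) with hK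
  have hlt : (2 : ℝ≥0∞) ^ (-u) < 1 := ENNReal.rpow_lt_one_of_one_lt_of_neg (by norm_num) (by linarith)
  have hKt : K ≠ ∞ := by
    refine ENNReal.mul_ne_top (ENNReal.rpow_ne_top_of_ne_zero h20 h2t)
      (ENNReal.mul_ne_top (ENNReal.rpow_ne_top_of_ne_zero h20 h2t) (ENNReal.inv_ne_top.2 ?_))
    exact (tsub_pos_of_lt hlt).ne'
  -- The added 1 makes the constant visibly nonzero, so that the bound is infinite wherever `F` is.
  refine ⟨K + 1, by simp [hKt], fun F hF => ?_⟩
  have hmF : ∀ k : ℤ, MeasurableSet {y | (2 : ℝ≥0∞) ^ ((k : ℝ) - 1) < F y} := fun k =>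
    measurableSet_lt measurable_const hF
  have hmM : ∀ k : ℤ, MeasurableSet {y | (2 : ℝ≥0∞) ^ (k : ℝ) < maxFn F y} := fun k =>
    measurableSet_lt measurable_const (measurable_maxFn F)
  have hlevel : ∀ k : ℤ, haar p n {x | (2 : ℝ≥0∞) ^ (k : ℝ) < maxFn F x} ≤
      (2 : ℝ≥0∞) ^ (1 - (k : ℝ)) *
        ∫⁻ x, {y | (2 : ℝ≥0∞) ^ ((k : ℝ) - 1) < F y}.indicator F x ∂haar p n := by
    intro k
    have hw := mul_haar_lt_maxFn_le (hF.indicator (hmF k)).aemeasurable ((2 : ℝ≥0∞) ^ ((k : ℝ) - 1))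
    have hsub : {x | (2 : ℝ≥0∞) ^ (k : ℝ) < maxFn F x} ⊆ {x | (2 : ℝ≥0∞) ^ ((k : ℝ) - 1) <
        maxFn ({y | (2 : ℝ≥0∞) ^ ((k : ℝ) - 1) < F y}.indicator F) x} := by
      intro x hx
      refine lt_maxFn_indicator hF ?_
      have : (2 : ℝ≥0∞) * 2 ^ ((k : ℝ) - 1) = 2 ^ (k : ℝ) := by
        nth_rewrite 1 [← ENNReal.rpow_one 2]
        rw [← ENNReal.rpow_add _ _ h20 h2t]; congr 1; ring
      rw [this]; exact hx
    calc haar p n {x | (2 : ℝ≥0∞) ^ (k : ℝ) < maxFn F x}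
        ≤ (2 : ℝ≥0∞) ^ (1 - (k : ℝ)) * (2 ^ ((k : ℝ) - 1) * haar p n {x | (2 : ℝ≥0∞) ^ ((k : ℝ) - 1) <
        maxFn ({y | (2 : ℝ≥0∞) ^ ((k : ℝ) - 1) < F y}.indicator F) x}) := by
          rw [← mul_assoc, ← ENNReal.rpow_add _ _ h20 h2t]
          simpa using measure_mono hsub
      _ ≤ _ := by gcongr
  -- Marcinkiewicz interpolation: the weak estimate is applied at each level `2 ^ k` to the part of
  -- `F` above `2 ^ (k - 1)`. After exchanging sum and integral, a geometric series with exponent `u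
  -- = s - 1` remains at each point.
  calc ∫⁻ x, maxFn F x ^ s ∂haar p n
      ≤ ∫⁻ x, ∑' k : ℤ, (2 : ℝ≥0∞) ^ (s * (k + 1)) *
          (if (2 : ℝ≥0∞) ^ (k : ℝ) < maxFn F x then 1 else 0) ∂haar p n :=
        lintegral_mono fun x => rpow_le_tsum_dyadic (by linarith) _
    _ = ∑' k : ℤ, (2 : ℝ≥0∞) ^ (s * (k + 1)) * haar p n {x | (2 : ℝ≥0∞) ^ (k : ℝ) < maxFn F x} := by
        rw [lintegral_tsum fun k => ((Measurable.ite (hmM k) measurable_const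
          measurable_const).const_mul _).aemeasurable]
        refine tsum_congr fun k => ?_
        rw [lintegral_const_mul' _ _ (ENNReal.rpow_ne_top_of_ne_zero h20 h2t)]
        congr 1
        rw [← lintegral_indicator_one (hmM k)]
        simp only [Set.indicator_apply, Set.mem_ofPred_eq, Pi.one_apply]
    _ ≤ ∑' k : ℤ, (2 : ℝ≥0∞) ^ (s * (k + 1)) * ((2 : ℝ≥0∞) ^ (1 - (k : ℝ)) *
        ∫⁻ x, {y | (2 : ℝ≥0∞) ^ ((k : ℝ) - 1) < F y}.indicator F x ∂haar p n) := by
        gcongr with k; exact hlevel k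
    _ = ∫⁻ x, ∑' k : ℤ, ((2 : ℝ≥0∞) ^ (s * (k + 1)) * (2 : ℝ≥0∞) ^ (1 - (k : ℝ))) *
        {y | (2 : ℝ≥0∞) ^ ((k : ℝ) - 1) < F y}.indicator F x ∂haar p n := by
        rw [lintegral_tsum fun k => ((hF.indicator (hmF k)).const_mul _).aemeasurable]
        refine tsum_congr fun k => ?_
        rw [lintegral_const_mul _ (hF.indicator (hmF k)), mul_assoc]
    _ ≤ ∫⁻ x, (K + 1) * F x ^ s ∂haar p n := by
        refine lintegral_mono fun x => ?_
        have hterm : ∀ k : ℤ, ((2 : ℝ≥0∞) ^ (s * (k + 1)) * (2 : ℝ≥0∞) ^ (1 - (k : ℝ))) *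
            {y | (2 : ℝ≥0∞) ^ ((k : ℝ) - 1) < F y}.indicator F x =
            ((2 : ℝ≥0∞) ^ (s + 1) * F x) * ((2 : ℝ≥0∞) ^ (u * k) *
              (if (2 : ℝ≥0∞) ^ ((k : ℝ) - 1) < F x then 1 else 0)) := by
          intro k
          have he : (2 : ℝ≥0∞) ^ (s * (k + 1)) * (2 : ℝ≥0∞) ^ (1 - (k : ℝ)) =
              (2 : ℝ≥0∞) ^ (s + 1) * (2 : ℝ≥0∞) ^ (u * k) := by
            rw [← ENNReal.rpow_add _ _ h20 h2t, ← ENNReal.rpow_add _ _ h20 h2t, hu]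
            congr 1; ring
          rw [he, Set.indicator_apply]
          simp only [Set.mem_ofPred_eq]
          split_ifs <;> ring
        simp_rw [hterm]
        rw [ENNReal.tsum_mul_left]
        rcases eq_or_ne (F x) 0 with h0 | h0
        · simp [h0]
        rcases eq_or_ne (F x) ∞ with ht | ht
        · rw [ht, ENNReal.top_rpow_of_pos (by linarith), ENNReal.mul_top (by simp)]
          simp
        calc (2 : ℝ≥0∞) ^ (s + 1) * F x * _
            ≤ (2 : ℝ≥0∞) ^ (s + 1) * F x *
              ((2 : ℝ≥0∞) ^ (2 * u) * (1 - (2 : ℝ≥0∞) ^ (-u))⁻¹ * F x ^ u) := by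
              gcongr; exact tsum_dyadic_le hu0 h0 ht
          _ = K * (F x ^ (1 : ℝ) * F x ^ u) := by rw [hK, ENNReal.rpow_one]; ring
          _ = K * F x ^ s := by
              rw [← ENNReal.rpow_add _ _ h0 ht, hu]; congr 2; ring
          _ ≤ (K + 1) * F x ^ s := by gcongr; exact le_self_add
    _ = _ := lintegral_const_mul _ (hF.pow_const s)

/-! ### Constant exponents -/

lemma avg_rpow_le_div_vol {F : Space p n → ℝ≥0∞} (hF : AEMeasurable F (haar p n)) {R : ℝ}
    (hR : 1 ≤ R) {A : ℝ≥0∞} (hA : ∫⁻ x, F x ^ R ∂haar p n ≤ A) (γ : ℤ) (x : Space p n) :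
    avg F γ x ^ R ≤ A * (vol p n γ)⁻¹ :=
  (avg_rpow_le hF hR γ x).trans ((avg_le_vol_inv_mul _ γ x).trans (by rw [mul_comm]; gcongr))

lemma avg_le_div_vol_rpow {F : Space p n → ℝ≥0∞} (hF : AEMeasurable F (haar p n)) {R : ℝ}
    (hR : 1 ≤ R) {A : ℝ≥0∞} (hA : ∫⁻ x, F x ^ R ∂haar p n ≤ A) (γ : ℤ) (x : Space p n) :
    avg F γ x ≤ A ^ (1 / R) * vol p n γ ^ (-(1 / R)) := by
  have h0 : 0 < R := by linarith
  have h := ENNReal.rpow_le_rpow (avg_rpow_le_div_vol hF hR hA γ x) (one_div_nonneg.2 h0.le)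
  rwa [← ENNReal.rpow_mul, mul_one_div_cancel h0.ne', ENNReal.rpow_one,
    ENNReal.mul_rpow_of_nonneg _ _ (one_div_nonneg.2 h0.le), ENNReal.inv_rpow,
    ← ENNReal.rpow_neg] at h

/-- Hedberg's pointwise estimate for the fractional maximal function. -/
lemma fracMax_rpow_le {F : Space p n → ℝ≥0∞} (hF : AEMeasurable F (haar p n)) {α R Q : ℝ}
    (hα : 0 ≤ α) (hR : 1 ≤ R) (hQ : 0 < Q) (hRQ : 1 / Q = 1 / R - α) {A : ℝ≥0∞}
    (hA : ∫⁻ x, F x ^ R ∂haar p n ≤ A) (x : Space p n) :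
    fracMax α F x ^ Q ≤ A ^ (α * Q) * maxFn F x ^ R := by
  have hR0 : 0 < R := by linarith
  have hle : R ≤ Q := by
    have : 1 / Q ≤ 1 / R := by linarith
    exact (one_div_le_one_div hQ hR0).1 this
  have hV := vol_ne_zero p n
  have hV' := vol_ne_top p n
  have hα' : (1 / R) * (1 - R / Q) = α := by
    have : α = 1 / R - 1 / Q := by linarith
    rw [this]; field_simp
  have hdiv : R / Q ≤ 1 := (div_le_one hQ).2 hle
  -- The average is split into its powers `R / Q` and `1 - R / Q`. The first is bounded by the
  -- maximal function; the `L^R` bound on the second contributes `|B| ^ (-α)`, which cancels the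
  -- fractional factor.
  have key : fracMax α F x ≤ A ^ α * maxFn F x ^ (R / Q) := by
    refine iSup_le fun γ => ?_
    calc vol p n γ ^ α * avg F γ x
        = vol p n γ ^ α * (avg F γ x ^ (R / Q) * avg F γ x ^ (1 - R / Q)) := by
          rw [← ENNReal.rpow_add_of_nonneg _ _ (by positivity) (by linarith)]; simp
      _ ≤ vol p n γ ^ α * (maxFn F x ^ (R / Q) *
          (A ^ (1 / R) * vol p n γ ^ (-(1 / R))) ^ (1 - R / Q)) := by
          gcongr
          · exact avg_le_maxFn F γ x
          · exact avg_le_div_vol_rpow hF hR hA γ x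
      _ = A ^ α * maxFn F x ^ (R / Q) := by
          rw [ENNReal.mul_rpow_of_nonneg _ _ (by linarith), ← ENNReal.rpow_mul,
            ← ENNReal.rpow_mul, hα', neg_mul, hα', ENNReal.rpow_neg]
          calc _ = (vol p n γ ^ α * (vol p n γ ^ α)⁻¹) * (A ^ α * maxFn F x ^ (R / Q)) := by ring
            _ = _ := by
              rw [ENNReal.mul_inv_cancel, one_mul]
              · exact (ENNReal.rpow_pos (pos_iff_ne_zero.2 (hV γ)) (hV' γ)).ne'
              · exact ENNReal.rpow_ne_top_of_ne_zero (hV γ) (hV' γ)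
  calc fracMax α F x ^ Q ≤ (A ^ α * maxFn F x ^ (R / Q)) ^ Q := by gcongr
    _ = _ := by
      rw [ENNReal.mul_rpow_of_nonneg _ _ hQ.le, ← ENNReal.rpow_mul, ← ENNReal.rpow_mul,
        div_mul_cancel₀ _ hQ.ne']

/-- The fractional maximal function of a bounded function in a Lebesgue space is bounded. -/
lemma fracMax_le_max {F : Space p n → ℝ≥0∞} (hF : AEMeasurable F (haar p n)) {α R : ℝ}
    (hα : 0 ≤ α) (hR : 1 ≤ R) (hαR : α ≤ 1 / R) {A K : ℝ≥0∞}
    (hA : ∫⁻ x, F x ^ R ∂haar p n ≤ A) (hK : ∀ x, F x ≤ K) (x : Space p n) :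
    fracMax α F x ≤ max K (A ^ (1 / R)) := by
  refine iSup_le fun γ => ?_
  -- Balls of measure at most 1 use the bound `K`; balls of measure at least 1 use the `L^R` bound
  -- and `α ≤ 1 / R`.
  rcases le_total γ 0 with h | h
  · refine le_max_of_le_left ?_
    calc vol p n γ ^ α * avg F γ x ≤ 1 * K := by
          gcongr
          · exact ENNReal.rpow_le_one (vol_le_one p n h) hα
          · exact avg_le_of_le (.of_forall fun y _ => hK y)
      _ = K := one_mul K
  · refine le_max_of_le_right ?_
    calc vol p n γ ^ α * avg F γ x ≤ vol p n γ ^ α * (A ^ (1 / R) * vol p n γ ^ (-(1 / R))) := by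
          gcongr; exact avg_le_div_vol_rpow hF hR hA γ x
      _ = A ^ (1 / R) * vol p n γ ^ (α - 1 / R) := by
          rw [mul_left_comm, ← ENNReal.rpow_add _ _ (vol_ne_zero p n γ) (vol_ne_top p n γ)]; rfl
      _ ≤ A ^ (1 / R) * 1 := by
          gcongr
          rcases (show α - 1 / R ≤ 0 by linarith).eq_or_lt with h0 | h0
          · rw [h0, ENNReal.rpow_zero]
          · exact ENNReal.rpow_le_one_of_one_le_of_neg (one_le_vol p n h) h0
      _ = _ := mul_one _

/-- Averages over large balls do not see an averaging over unit balls. -/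
lemma avg_avg {F : Space p n → ℝ≥0∞} (hF : AEMeasurable F (haar p n)) {γ δ : ℤ} (h : γ ≤ δ)
    (x : Space p n) : avg (avg F γ) δ x = avg F δ x := by
  rw [avg, setLIntegral_avg hF fun y hy => pBall_subset_of_mem h hy, avg]

open Filter Topology

/-! ### Variable exponents -/

lemma IsExponent.one_lt {q : Space p n → ℝ} (hq : IsExponent q) (x : Space p n) : 1 < q x :=
  hq.one_lt_inf.trans_le (hq.inf_le x)

lemma ae_restrict_pBall_neBot (γ : ℤ) (x : Space p n) :
    (ae ((haar p n).restrict (pBall γ x))).NeBot := by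
  rw [ae_neBot, Ne, Measure.restrict_eq_zero, haar_pBall_eq_vol]
  exact vol_ne_zero p n γ

lemma IsExponent.ae_mem_Icc {q : Space p n → ℝ} (hq : IsExponent q) (γ : ℤ) (x : Space p n) :
    ∀ᵐ y ∂haar p n, y ∈ pBall γ x → q y ∈ Set.Icc (expInf q (pBall γ x)) (expSup q (pBall γ x)) := by
  obtain ⟨K, hK⟩ := hq.bounded
  have h1 : ∀ᵐ y ∂(haar p n).restrict (pBall γ x), expInf q (pBall γ x) ≤ q y :=
    ae_essInf_le (isBoundedUnder_of ⟨-K, fun y => (abs_le.1 (hK y)).1⟩)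
  have h2 : ∀ᵐ y ∂(haar p n).restrict (pBall γ x), q y ≤ expSup q (pBall γ x) :=
    ae_le_essSup (isBoundedUnder_of ⟨K, fun y => (abs_le.1 (hK y)).2⟩)
  exact (ae_restrict_iff' (measurableSet_pBall γ x)).1 (h1.and h2)

lemma IsExponent.inf_le_expInf {q : Space p n → ℝ} (hq : IsExponent q) (γ : ℤ) (x : Space p n) :
    expInf q Set.univ ≤ expInf q (pBall γ x) := by
  obtain ⟨K, hK⟩ := hq.bounded
  have := ae_restrict_pBall_neBot γ x
  refine le_essInf_of_ae_le _ (.of_forall fun y => hq.inf_le y) ?_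
  exact (isBoundedUnder_of ⟨K, fun y => (abs_le.1 (hK y)).2⟩ :
    IsBoundedUnder (· ≤ ·) (ae ((haar p n).restrict (pBall γ x))) q).isCoboundedUnder_ge

/-- The pointwise form of local log-Hölder continuity. -/
lemma IsLogHolder.exists_local_bound {q : Space p n → ℝ} (hq : IsLogHolder q) :
    ∃ C : ℝ, 0 < C ∧ ∀ᵐ x ∂haar p n, ∀ γ : ℤ, γ ≤ 0 → ∃ ρ : ℝ, expInf q Set.univ ≤ ρ ∧ ρ ≤ q x ∧
      (∀ᵐ y ∂haar p n, y ∈ pBall γ x → ρ ≤ q y) ∧ (-γ : ℝ) * (q x - ρ) ≤ C := by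
  obtain ⟨C, hC, hloc⟩ := hq.local_bound
  have hE := hq.isExponent
  -- Balls of a given radius are equal or disjoint, so those centred at a dense sequence are all of
  -- them, and countably many null sets are discarded.
  have hx : ∀ᵐ x ∂haar p n, ∀ γ : ℤ,
      q x ∈ Set.Icc (expInf q (pBall γ x)) (expSup q (pBall γ x)) := by
    rw [ae_all_iff]
    intro γ
    have : ∀ᵐ y ∂haar p n, ∀ i : ℕ, y ∈ pBall γ (TopologicalSpace.denseSeq (Space p n) i) →
        q y ∈ Set.Icc (expInf q (pBall γ (TopologicalSpace.denseSeq (Space p n) i)))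
          (expSup q (pBall γ (TopologicalSpace.denseSeq (Space p n) i))) :=
      ae_all_iff.2 fun i => hE.ae_mem_Icc γ _
    filter_upwards [this] with x hx
    obtain ⟨i, hi⟩ := (TopologicalSpace.denseRange_denseSeq (Space p n)).exists_mem_open
      (isOpen_pBall γ x) ⟨x, mem_pBall_self γ x⟩
    rw [pBall_eq_of_mem hi]
    exact hx i (mem_pBall_comm.1 hi)
  refine ⟨C, hC, ?_⟩
  filter_upwards [hx] with x hx γ hγ
  refine ⟨expInf q (pBall γ x), hE.inf_le_expInf γ x, (hx γ).1,
    (hE.ae_mem_Icc γ x).mono fun y hy h => (hy h).1, ?_⟩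
  have h0 : (0 : ℝ) ≤ -γ := by exact_mod_cast neg_nonneg.2 hγ
  have := mul_le_mul_of_nonneg_left (hx γ).2 h0
  have := hloc γ x
  linarith

/-- The logarithmic size `log_p (p + |x|)`. -/
def logSize (x : Space p n) : ℝ := Real.logb p (p + ‖x‖)

lemma one_le_logSize (x : Space p n) : 1 ≤ logSize x := by
  have h1 := one_lt_prime_real p
  rw [logSize, Real.le_logb_iff_rpow_le h1 (by positivity), Real.rpow_one]
  linarith [norm_nonneg x]

lemma rpow_logSize (x : Space p n) : (p : ℝ) ^ logSize x = p + ‖x‖ := by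
  have h1 := one_lt_prime_real p
  exact Real.rpow_logb (by linarith) h1.ne' (by positivity)

/-- Along a sequence escaping to infinity the minimum of the two norms is eventually `‖x‖`. -/
lemma abs_sub_limit_le {q : Space p n → ℝ} {C : ℝ}
    (hC : ∀ x y : Space p n, |q x - q y| ≤ C / Real.logb p (p + min ‖x‖ ‖y‖))
    {u : ℕ → Space p n} (hu : Tendsto (fun k => ‖u k‖) atTop atTop) {Q : ℝ}
    (hQ : Tendsto (fun k => q (u k)) atTop (𝓝 Q)) (x : Space p n) :
    |q x - Q| ≤ C / logSize x := by
  refine le_of_tendsto (tendsto_const_nhds.sub hQ).abs ?_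
  filter_upwards [hu.eventually_ge_atTop ‖x‖] with k hk
  simpa [logSize, min_eq_left hk] using hC x (u k)

/-- Log-Hölder exponents that are related by `1 / q = 1 / r - α` have limits at infinity, which
are related in the same way. -/
lemma exists_limit_exponents (hn : 1 ≤ n) {r q : Space p n → ℝ} (hr : IsLogHolder r)
    (hq : IsLogHolder q) {α : ℝ} (h : ∀ x, 1 / q x = 1 / r x - α) :
    ∃ R Q C : ℝ, 1 < R ∧ 1 < Q ∧ 0 < C ∧ 1 / Q = 1 / R - α ∧
      (∀ x, |r x - R| ≤ C / logSize x) ∧ ∀ x, |q x - Q| ≤ C / logSize x := by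
  obtain ⟨C₁, hC₁, h1⟩ := hr.decay
  obtain ⟨C₂, hC₂, h2⟩ := hq.decay
  obtain ⟨K, hK⟩ := hr.isExponent.bounded
  obtain ⟨L, hL⟩ := hq.isExponent.bounded
  let v : ℕ → Space p n := fun k _ => (p : ℚ_[p]) ^ (-(k : ℤ))
  have hv : Tendsto (fun k => ‖v k‖) atTop atTop := by
    have : Nonempty (Fin n) := ⟨⟨0, hn⟩⟩
    have hvk : ∀ k, ‖v k‖ = (p : ℝ) ^ k := by
      intro k
      simp only [v]
      rw [pi_norm_const, Padic.norm_p_zpow]; simp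
    simp_rw [hvk]
    exact tendsto_pow_atTop_atTop_of_one_lt (one_lt_prime_real p)
  -- Compactness is applied to the pair, so that one subsequence serves both exponents and their
  -- relation passes to the limit.
  obtain ⟨⟨R, Q⟩, -, φ, hφ, hlim⟩ := tendsto_subseq_of_bounded
    (Metric.isBounded_closedBall (x := (0 : ℝ × ℝ)) (r := max K L))
    (x := fun k => (r (v k), q (v k))) (fun k => by
      rw [mem_closedBall_zero_iff, Prod.norm_def]
      exact max_le_max (hK _) (hL _))
  have hR : Tendsto (fun k => r (v (φ k))) atTop (𝓝 R) := (continuous_fst.tendsto _).comp hlim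
  have hQ : Tendsto (fun k => q (v (φ k))) atTop (𝓝 Q) := (continuous_snd.tendsto _).comp hlim
  have hu := hv.comp hφ.tendsto_atTop
  have hR1 : 1 < R := hr.isExponent.one_lt_inf.trans_le
    (ge_of_tendsto' hR fun k => hr.isExponent.inf_le _)
  have hQ1 : 1 < Q := hq.isExponent.one_lt_inf.trans_le
    (ge_of_tendsto' hQ fun k => hq.isExponent.inf_le _)
  refine ⟨R, Q, max C₁ C₂, hR1, hQ1, lt_max_of_lt_left hC₁, ?_, fun x => ?_, fun x => ?_⟩
  · have hl := tendsto_const_nhds (x := (1 : ℝ)).div hQ (by linarith)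
    have hl' := (tendsto_const_nhds (x := (1 : ℝ)).div hR (by linarith)).sub_const α
    refine tendsto_nhds_unique hl (hl'.congr fun k => (h _).symm)
  · have := one_le_logSize x
    exact (abs_sub_limit_le h1 hu hR x).trans (by gcongr; exact le_max_left _ _)
  · have := one_le_logSize x
    exact (abs_sub_limit_le h2 hu hQ x).trans (by gcongr; exact le_max_right _ _)

/-! ### Changing the exponent at infinity -/

/-- An integrable weight with polynomial decay. -/
def weight (x : Space p n) : ℝ≥0∞ :=
  ∑' k : ℕ, (pBall (k : ℤ) (0 : Space p n)).indicator
    (fun _ => (p : ℝ≥0∞) ^ (-((n : ℝ) + 1) * k)) x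

lemma measurable_weight : Measurable (weight : Space p n → ℝ≥0∞) :=
  Measurable.tsum fun _ => measurable_const.indicator (measurableSet_pBall _ _)

lemma lintegral_weight_ne_top : ∫⁻ x, weight x ∂haar p n ≠ ∞ := by
  have h : ∫⁻ x, weight x ∂haar p n = ∑' k : ℕ, ((p : ℝ≥0∞)⁻¹) ^ k := by
    unfold weight
    rw [lintegral_tsum fun k => (measurable_const.indicator (measurableSet_pBall _ _)).aemeasurable]
    refine tsum_congr fun k => ?_
    rw [lintegral_indicator (measurableSet_pBall _ _), setLIntegral_const, haar_pBall,
      ← ENNReal.rpow_add _ _ (prime_ne_zero p) (prime_ne_top p), ← ENNReal.inv_pow,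
      ← ENNReal.rpow_natCast, ← ENNReal.rpow_neg]
    congr 1; push_cast; ring
  rw [h, ENNReal.tsum_geometric]
  refine ENNReal.inv_ne_top.2 (tsub_pos_of_lt ?_).ne'
  exact ENNReal.inv_lt_one.2 (one_lt_prime p)

/-- As `p ^ logSize x = p + ‖x‖`, the term of index `⌈logSize x⌉` is present at `x`; the factor 2
absorbs the rounding because `logSize x ≥ 1`. -/
lemma rpow_le_weight (x : Space p n) :
    (p : ℝ≥0∞) ^ (-(2 * ((n : ℝ) + 1) * logSize x)) ≤ weight x := by
  set k := ⌈logSize x⌉₊ with hk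
  have h1 := one_le_logSize x
  have hp := one_lt_prime_real p
  have hkl : (k : ℝ) ≤ 2 * logSize x := by
    have := Nat.ceil_lt_add_one (show 0 ≤ logSize x by linarith)
    linarith
  have hx : x ∈ pBall (k : ℤ) (0 : Space p n) := by
    rw [pBall, mem_closedBall, dist_zero_right, zpow_natCast, ← Real.rpow_natCast]
    calc ‖x‖ ≤ p + ‖x‖ := by linarith
      _ = (p : ℝ) ^ logSize x := (rpow_logSize x).symm
      _ ≤ _ := Real.rpow_le_rpow_of_exponent_le hp.le (Nat.le_ceil _)
  refine le_trans ?_ (ENNReal.le_tsum k)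
  rw [Set.indicator_of_mem hx]
  refine ENNReal.rpow_le_rpow_of_exponent_le (one_lt_prime p).le ?_
  have : (0 : ℝ) ≤ n + 1 := by positivity
  nlinarith

/-- Either `g` is at most the weight, and then so is `g ^ s`; or `g` is at least `p ^ (-2 (n + 1)
logSize x)`, and then an exponent change of size `C / logSize x` costs only a constant. -/
lemma rpow_le_mul_rpow_add_weight {C s t : ℝ} {x : Space p n} (hC : 0 ≤ C) (hs : 1 ≤ s)
    (hst : |s - t| ≤ C / logSize x) {g : ℝ≥0∞} (hg : g ≤ 1) :
    g ^ s ≤ (p : ℝ≥0∞) ^ (2 * ((n : ℝ) + 1) * C) * g ^ t + weight x := by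
  have hp := (one_lt_prime p).le
  have hl := one_le_logSize x
  rcases le_or_gt g (weight x) with h | h
  · refine le_add_left (le_trans ?_ h)
    simpa using ENNReal.rpow_le_rpow_of_exponent_ge hg hs
  refine le_add_right ?_
  have hg0 : g ≠ 0 := (pos_of_gt h).ne'
  have hgt : g ≠ ∞ := (hg.trans_lt ENNReal.one_lt_top).ne
  have hst' : t - s ≤ C / logSize x := by rw [abs_sub_comm] at hst; exact (le_abs_self _).trans hst
  have : g ^ s = g ^ (s - t) * g ^ t := by
    rw [← ENNReal.rpow_add _ _ hg0 hgt]; congr 1; ring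
  rw [this]
  gcongr
  rcases le_total t s with hts | hts
  · refine (ENNReal.rpow_le_one hg (by linarith)).trans ?_
    simpa using ENNReal.rpow_le_rpow_of_exponent_le hp
      (show 0 ≤ 2 * ((n : ℝ) + 1) * C by positivity)
  calc g ^ (s - t) = (g⁻¹) ^ (t - s) := by
        rw [ENNReal.inv_rpow, ← ENNReal.rpow_neg]; congr 1; ring
    _ ≤ (((p : ℝ≥0∞) ^ (-(2 * ((n : ℝ) + 1) * logSize x)))⁻¹) ^ (t - s) := by
        gcongr
        exact (rpow_le_weight x).trans h.le
    _ = (p : ℝ≥0∞) ^ (2 * ((n : ℝ) + 1) * logSize x * (t - s)) := by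
        rw [ENNReal.rpow_neg, inv_inv, ← ENNReal.rpow_mul]
    _ ≤ _ := by
        refine ENNReal.rpow_le_rpow_of_exponent_le hp ?_
        rw [mul_assoc]
        refine mul_le_mul_of_nonneg_left ?_ (by positivity)
        rw [le_div_iff₀ (by linarith)] at hst'
        linarith

/-- For bounded functions, exponents with the same limit at infinity are interchangeable. -/
lemma lintegral_rpow_le_of_decay {C S : ℝ} (hC : 0 ≤ C) {s t : Space p n → ℝ}
    (hs : ∀ x, 1 ≤ s x) (hS : ∀ x, s x ≤ S) (ht : ∀ x, 0 ≤ t x)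
    (hst : ∀ x, |s x - t x| ≤ C / logSize x) {K : ℝ≥0∞} (hK1 : 1 ≤ K) (hK : K ≠ ∞)
    {g : Space p n → ℝ≥0∞} (hg : ∀ x, g x ≤ K) :
    ∫⁻ x, g x ^ s x ∂haar p n ≤ K ^ S * ((p : ℝ≥0∞) ^ (2 * ((n : ℝ) + 1) * C) *
      ∫⁻ x, g x ^ t x ∂haar p n + ∫⁻ x, weight x ∂haar p n) := by
  have hK0 : K ≠ 0 := (one_pos.trans_le hK1).ne'
  have hS0 : 0 ≤ S := by linarith [hs 0, hS 0]
  have hD : (p : ℝ≥0∞) ^ (2 * ((n : ℝ) + 1) * C) ≠ ∞ :=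
    ENNReal.rpow_ne_top_of_ne_zero (prime_ne_zero p) (prime_ne_top p)
  calc ∫⁻ x, g x ^ s x ∂haar p n
      ≤ ∫⁻ x, K ^ S * ((p : ℝ≥0∞) ^ (2 * ((n : ℝ) + 1) * C) * g x ^ t x + weight x) ∂haar p n := by
        refine lintegral_mono fun x => ?_
        -- Exponents can be exchanged only for values at most 1, hence the rescaling by `K`.
        have h1 : K⁻¹ * g x ≤ 1 := by
          rw [mul_comm, ← div_eq_mul_inv]
          exact ENNReal.div_le_of_le_mul (by simpa using hg x)
        have h2 : g x = K * (K⁻¹ * g x) := by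
          rw [← mul_assoc, ENNReal.mul_inv_cancel hK0 hK, one_mul]
        calc g x ^ s x = K ^ s x * (K⁻¹ * g x) ^ s x := by
              rw [← ENNReal.mul_rpow_of_nonneg _ _ (by linarith [hs x]), ← h2]
          _ ≤ K ^ S * ((p : ℝ≥0∞) ^ (2 * ((n : ℝ) + 1) * C) * (K⁻¹ * g x) ^ t x + weight x) := by
              gcongr
              · exact hS x
              · exact rpow_le_mul_rpow_add_weight hC (hs x) (hst x) h1
          _ ≤ _ := by
              gcongr
              · exact ht x
              · calc K⁻¹ * g x ≤ 1 * g x := by gcongr; exact ENNReal.inv_le_one.2 hK1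
                  _ = g x := one_mul _
    _ = _ := by
        rw [lintegral_const_mul' _ _ (ENNReal.rpow_ne_top_of_nonneg hS0 hK),
          lintegral_add_right _ measurable_weight, lintegral_const_mul' _ _ hD]

/-! ### Boundedness of the fractional maximal function for variable exponents -/

lemma exponent_le {r q : Space p n → ℝ} (hr : IsExponent r) (hq : IsExponent q) {α : ℝ}
    (hα : 0 ≤ α) (h : ∀ x, 1 / q x = 1 / r x - α) (x : Space p n) : r x ≤ q x := by
  have h1 := hr.one_lt x
  have h2 := hq.one_lt x
  refine (one_div_le_one_div (by linarith) (by linarith)).1 ?_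
  linarith [h x]

lemma rpow_le_rpow_of_zero_or_one_le {a : ℝ≥0∞} (ha : a = 0 ∨ 1 ≤ a) {s t : ℝ} (hs : 0 < s)
    (hst : s ≤ t) : a ^ s ≤ a ^ t := by
  rcases ha with rfl | ha
  · simp [hs]
  · exact ENNReal.rpow_le_rpow_of_exponent_le ha hst

lemma vol_rpow_le {γ : ℤ} {e c : ℝ} (h : (γ : ℝ) * e ≤ c) :
    vol p n γ ^ e ≤ (p : ℝ≥0∞) ^ ((n : ℝ) * c) := by
  rw [vol_rpow, mul_assoc]
  exact ENNReal.rpow_le_rpow_of_exponent_le (one_lt_prime p).le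
    (mul_le_mul_of_nonneg_left h n.cast_nonneg)

/-- On small balls the averages of a function with values in `{0} ∪ [1, ∞]` are controlled by the
maximal function of a power, for a constant exponent. -/
lemma exists_small_ball_estimate {r q : Space p n → ℝ} (hr : IsLogHolder r) (hq : IsExponent q)
    {α : ℝ} (hα : 0 ≤ α) (h : ∀ x, 1 / q x = 1 / r x - α) :
    ∃ D : ℝ≥0∞, D ≠ ∞ ∧ ∀ F : Space p n → ℝ≥0∞, Measurable F → (∀ y, F y = 0 ∨ 1 ≤ F y) →
      ∫⁻ y, F y ^ r y ∂haar p n ≤ 1 → ∀ᵐ x ∂haar p n, ∀ γ : ℤ, γ ≤ 0 →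
        (vol p n γ ^ α * avg F γ x) ^ q x ≤
          D * maxFn (fun y => F y ^ (r y / expInf r Set.univ)) x ^ expInf r Set.univ := by
  obtain ⟨C, hC, hloc⟩ := hr.exists_local_bound
  obtain ⟨L, hL⟩ := hq.bounded
  set s := expInf r Set.univ with hs
  have hs1 : 1 < s := hr.isExponent.one_lt_inf
  set D₀ : ℝ≥0∞ := (p : ℝ≥0∞) ^ ((n : ℝ) * C) with hD₀
  have hD₀1 : 1 ≤ D₀ := by
    simpa using ENNReal.rpow_le_rpow_of_exponent_le (one_lt_prime p).le
      (show 0 ≤ (n : ℝ) * C by positivity)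
  have hD₀t : D₀ ≠ ∞ := ENNReal.rpow_ne_top_of_ne_zero (prime_ne_zero p) (prime_ne_top p)
  have hL0 : 0 ≤ L := (abs_nonneg _).trans (hL 0)
  refine ⟨D₀ ^ L * D₀, ENNReal.mul_ne_top (ENNReal.rpow_ne_top_of_nonneg hL0 hD₀t) hD₀t,
    fun F hF hF01 hF1 => ?_⟩
  filter_upwards [hloc] with x hx γ hγ
  obtain ⟨ρ, hsρ, hρx, hρy, hρC⟩ := hx γ hγ
  have hρ0 : 0 < ρ := by linarith
  have hq1 := hq.one_lt x
  have hq0 : 0 < q x := by linarith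
  have hr0 : 0 < r x := by linarith
  have hrq : r x / q x ≤ 1 := (div_le_one hq0).2 (exponent_le hr.isExponent hq hα h x)
  have hαr : 1 - r x / q x = α * r x := by
    have h3 : r x / q x = r x * (1 / q x) := by ring
    rw [h3, h x]; field_simp; ring
  have hα1 : α ≤ 1 := by
    have h4 : 1 / r x ≤ 1 := (div_le_one hr0).2 (by linarith)
    have h5 : 0 < 1 / q x := by positivity
    linarith [h x]
  have hγ0 : (0 : ℝ) ≤ -γ := by exact_mod_cast neg_nonneg.2 hγ
  have hγρ : 0 ≤ (-γ : ℝ) * (r x - ρ) := mul_nonneg hγ0 (by linarith)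
  set a := avg F γ x with ha
  -- As `F` takes values in `{0} ∪ [1, ∞]`, the exponent can be raised from the lower bound `ρ` on
  -- the ball to `r y`.
  have h1 : a ^ ρ ≤ (vol p n γ)⁻¹ := by
    calc a ^ ρ ≤ avg (fun y => F y ^ ρ) γ x := avg_rpow_le hF.aemeasurable (by linarith) γ x
      _ ≤ avg (fun y => F y ^ r y) γ x := avg_mono_on (hρy.mono fun y hy h =>
          rpow_le_rpow_of_zero_or_one_le (hF01 y) hρ0 (hy h))
      _ ≤ (vol p n γ)⁻¹ * ∫⁻ y, F y ^ r y ∂haar p n := avg_le_vol_inv_mul _ γ x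
      _ ≤ (vol p n γ)⁻¹ * 1 := by gcongr
      _ = _ := mul_one _
  have h2 : a ≤ vol p n γ ^ (-(1 / ρ)) := by
    have := ENNReal.rpow_le_rpow h1 (one_div_nonneg.2 hρ0.le)
    rwa [← ENNReal.rpow_mul, mul_one_div_cancel hρ0.ne', ENNReal.rpow_one, ENNReal.inv_rpow,
      ← ENNReal.rpow_neg] at this
  -- Local log-Hölder continuity enters here: `(-γ) (r x - ρ)` is bounded, so replacing `r x` by `ρ`
  -- in a power of `|B|` costs a constant.
  have hbound : ∀ c : ℝ, 0 ≤ c → c ≤ 1 → vol p n γ ^ (-(c * (r x - ρ) / ρ)) ≤ D₀ := by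
    intro c hc0 hc1
    refine vol_rpow_le ?_
    have h6 : (γ : ℝ) * -(c * (r x - ρ) / ρ) = ((-γ : ℝ) * (r x - ρ)) * (c / ρ) := by ring
    have h7 : c / ρ ≤ 1 := (div_le_one hρ0).2 (by linarith)
    rw [h6]
    calc ((-γ : ℝ) * (r x - ρ)) * (c / ρ) ≤ ((-γ : ℝ) * (r x - ρ)) * 1 := by gcongr
      _ ≤ C := by linarith
  -- Hedberg's splitting again, now with the exponents frozen at `x`.
  have h3 : vol p n γ ^ α * a ≤ D₀ * a ^ (r x / q x) := by
    calc vol p n γ ^ α * a = vol p n γ ^ α * (a ^ (r x / q x) * a ^ (1 - r x / q x)) := by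
          rw [← ENNReal.rpow_add_of_nonneg _ _ (by positivity) (by linarith)]; simp
      _ ≤ vol p n γ ^ α * (a ^ (r x / q x) * (vol p n γ ^ (-(1 / ρ))) ^ (1 - r x / q x)) := by
          gcongr
      _ = vol p n γ ^ (-(α * (r x - ρ) / ρ)) * a ^ (r x / q x) := by
          rw [← ENNReal.rpow_mul, hαr, mul_left_comm,
            ← ENNReal.rpow_add _ _ (vol_ne_zero p n γ) (vol_ne_top p n γ), mul_comm]
          congr 2; field_simp; ring
      _ ≤ D₀ * a ^ (r x / q x) := by gcongr; exact hbound α hα hα1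
  have h4 : a ^ (r x - ρ) ≤ D₀ := by
    calc a ^ (r x - ρ) ≤ (vol p n γ ^ (-(1 / ρ))) ^ (r x - ρ) := by gcongr
      _ = vol p n γ ^ (-(1 * (r x - ρ) / ρ)) := by
          rw [← ENNReal.rpow_mul]; congr 1; ring
      _ ≤ D₀ := hbound 1 zero_le_one le_rfl
  have h5 : a ^ ρ ≤ maxFn (fun y => F y ^ (r y / s)) x ^ s := by
    have hs0 : 0 < s := by linarith
    calc a ^ ρ = (a ^ (ρ / s)) ^ s := by rw [← ENNReal.rpow_mul, div_mul_cancel₀ _ hs0.ne']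
      _ ≤ (avg (fun y => F y ^ (ρ / s)) γ x) ^ s := by
          gcongr; exact avg_rpow_le hF.aemeasurable ((one_le_div hs0).2 hsρ) γ x
      _ ≤ (avg (fun y => F y ^ (r y / s)) γ x) ^ s := by
          gcongr
          refine avg_mono_on (hρy.mono fun y hy h =>
            rpow_le_rpow_of_zero_or_one_le (hF01 y) (by positivity) ?_)
          have := hy h
          gcongr
      _ ≤ _ := by gcongr; exact avg_le_maxFn _ γ x
  calc (vol p n γ ^ α * a) ^ q x ≤ (D₀ * a ^ (r x / q x)) ^ q x := by gcongr
    _ = D₀ ^ q x * (a ^ (r x - ρ) * a ^ ρ) := by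
        rw [ENNReal.mul_rpow_of_nonneg _ _ hq0.le, ← ENNReal.rpow_mul a, div_mul_cancel₀ _ hq0.ne',
          ← ENNReal.rpow_add_of_nonneg _ _ (by linarith) hρ0.le]
        congr 2; ring
    _ ≤ D₀ ^ L * (D₀ * maxFn (fun y => F y ^ (r y / s)) x ^ s) := by
        gcongr
        exact (le_abs_self _).trans (hL x)
    _ = _ := by ring

lemma add_rpow_le {a b : ℝ≥0∞} {t : ℝ} (ht : 0 ≤ t) : (a + b) ^ t ≤ 2 ^ t * (a ^ t + b ^ t) := by
  calc (a + b) ^ t ≤ (2 * max a b) ^ t := by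
        gcongr; rw [two_mul]; gcongr <;> simp
    _ = 2 ^ t * (max a b) ^ t := ENNReal.mul_rpow_of_nonneg _ _ ht
    _ ≤ _ := by
      gcongr
      rcases le_total a b with h | h
      · rw [max_eq_right h]; exact le_add_self
      · rw [max_eq_left h]; exact le_self_add

/-- The truncated pieces of a function in the unit ball, averaged over unit balls where the
function is large, lie in the Lebesgue space of the exponent at infinity. -/
lemma exists_lintegral_regularized_le {r : Space p n → ℝ} (hr : IsExponent r) {R C : ℝ}
    (hR : 1 < R) (hC : 0 ≤ C) (hrR : ∀ x, |r x - R| ≤ C / logSize x) :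
    ∃ A : ℝ≥0∞, A ≠ ∞ ∧ ∀ F₁ F₂ : Space p n → ℝ≥0∞, Measurable F₁ → Measurable F₂ →
      (∀ y, F₁ y = 0 ∨ 1 ≤ F₁ y) → (∀ y, F₂ y ≤ 1) → ∫⁻ y, F₁ y ^ r y ∂haar p n ≤ 1 →
      ∫⁻ y, F₂ y ^ r y ∂haar p n ≤ 1 →
      (∀ y, avg F₁ 0 y + F₂ y ≤ 2) ∧ ∫⁻ y, (avg F₁ 0 y + F₂ y) ^ R ∂haar p n ≤ A := by
  set B : ℝ≥0∞ := (1 : ℝ≥0∞) ^ R * ((p : ℝ≥0∞) ^ (2 * ((n : ℝ) + 1) * C) * 1 +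
    ∫⁻ x : Space p n, weight x ∂haar p n) with hB
  have hBt : B ≠ ∞ := by
    refine ENNReal.mul_ne_top (by simp) (ENNReal.add_ne_top.2 ⟨?_, lintegral_weight_ne_top⟩)
    rw [mul_one]
    exact ENNReal.rpow_ne_top_of_ne_zero (prime_ne_zero p) (prime_ne_top p)
  refine ⟨2 ^ R * (1 + B), ENNReal.mul_ne_top (ENNReal.rpow_ne_top_of_nonneg (by linarith) (by simp))
    (by simp [hBt]), fun F₁ F₂ hF₁ hF₂ h01 h2 hI₁ hI₂ => ?_⟩
  have hint : ∫⁻ y, F₁ y ∂haar p n ≤ 1 := by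
    refine le_trans (lintegral_mono fun y => ?_) hI₁
    simpa using rpow_le_rpow_of_zero_or_one_le (h01 y) one_pos (hr.one_lt y).le
  have hG1 : ∀ y, avg F₁ 0 y ≤ 1 := fun y =>
    (avg_le_vol_inv_mul F₁ 0 y).trans (by simpa [vol] using hint)
  have hGint : ∫⁻ y, avg F₁ 0 y ∂haar p n ≤ 1 := by
    have := setLIntegral_avg hF₁.aemeasurable (γ := 0) (A := Set.univ) fun _ _ => Set.subset_univ _
    rw [setLIntegral_univ, setLIntegral_univ] at this
    exact this.trans_le hint
  refine ⟨fun y => (add_le_add (hG1 y) (h2 y)).trans (by norm_num), ?_⟩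
  calc ∫⁻ y, (avg F₁ 0 y + F₂ y) ^ R ∂haar p n
      ≤ ∫⁻ y, 2 ^ R * (avg F₁ 0 y ^ R + F₂ y ^ R) ∂haar p n :=
        lintegral_mono fun y => add_rpow_le (by linarith)
    _ = 2 ^ R * (∫⁻ y, avg F₁ 0 y ^ R ∂haar p n + ∫⁻ y, F₂ y ^ R ∂haar p n) := by
        rw [lintegral_const_mul' _ _ (ENNReal.rpow_ne_top_of_nonneg (by linarith) (by simp)),
          lintegral_add_left ((measurable_avg F₁ 0).pow_const R)]
    _ ≤ 2 ^ R * (1 + B) := by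
        gcongr
        · refine le_trans (lintegral_mono fun y => ?_) hGint
          simpa using ENNReal.rpow_le_rpow_of_exponent_ge (hG1 y) hR.le
        -- The modular of `F₂` is controlled for `r`; the values are at most 1, so the decay
        -- condition exchanges `r` for `R`.
        · refine (lintegral_rpow_le_of_decay hC (s := fun _ => R) (t := r) (fun _ => hR.le)
            (fun _ => le_rfl) (fun x => by linarith [hr.one_lt x])
            (fun x => by rw [abs_sub_comm]; exact hrR x) le_rfl (by simp) h2).trans ?_
          rw [hB]; gcongr

/-- The fractional maximal function maps the unit ball of the variable exponent space with
exponent `r` to a bounded set for the modular with exponent `q`. -/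
theorem exists_lintegral_fracMax_rpow_le (hn : 1 ≤ n) {r q : Space p n → ℝ} (hr : IsLogHolder r)
    (hq : IsLogHolder q) {α : ℝ} (hα : 0 ≤ α) (h : ∀ x, 1 / q x = 1 / r x - α) :
    ∃ C : ℝ≥0∞, C ≠ ∞ ∧ ∀ F : Space p n → ℝ≥0∞, Measurable F →
      ∫⁻ x, F x ^ r x ∂haar p n ≤ 1 → ∫⁻ x, fracMax α F x ^ q x ∂haar p n ≤ C := by
  obtain ⟨R, Q, c, hR, hQ, hc, hRQ, hrR, hqQ⟩ := exists_limit_exponents hn hr hq h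
  obtain ⟨A, hA, hreg⟩ := exists_lintegral_regularized_le hr.isExponent hR hc.le hrR
  obtain ⟨D, hD, hsmall⟩ := exists_small_ball_estimate hr hq.isExponent hα h
  obtain ⟨L, hL⟩ := hq.isExponent.bounded
  set s := expInf r Set.univ with hs
  have hs1 : 1 < s := hr.isExponent.one_lt_inf
  obtain ⟨Ms, hMs, hmaxs⟩ := exists_lintegral_maxFn_rpow_le p n hs1
  obtain ⟨MR, hMR, hmaxR⟩ := exists_lintegral_maxFn_rpow_le p n hR
  have hL0 : 0 ≤ L := (abs_nonneg _).trans (hL 0)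
  have hqL : ∀ x, q x ≤ L := fun x => (le_abs_self _).trans (hL x)
  -- This is the uniform bound that `fracMax_le_max` gives for a function at most 2 whose `R`-th
  -- power has integral at most `A`.
  set K : ℝ≥0∞ := max 2 (A ^ (1 / R)) with hK
  have hKt : K ≠ ∞ := by
    rw [hK, Ne, max_eq_top, not_or]
    exact ⟨by simp, ENNReal.rpow_ne_top_of_nonneg (by positivity) hA⟩
  have hK1 : 1 ≤ K := le_max_of_le_left (by norm_num)
  have hQ0 : 0 < Q := by linarith
  set E : ℝ≥0∞ := K ^ L * ((p : ℝ≥0∞) ^ (2 * ((n : ℝ) + 1) * c) * (A ^ (α * Q) * (MR * A)) +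
    ∫⁻ x : Space p n, weight x ∂haar p n) with hE
  have hEt : E ≠ ∞ := by
    refine ENNReal.mul_ne_top (ENNReal.rpow_ne_top_of_nonneg hL0 hKt)
      (ENNReal.add_ne_top.2 ⟨ENNReal.mul_ne_top ?_ (ENNReal.mul_ne_top ?_ (ENNReal.mul_ne_top hMR hA)),
        lintegral_weight_ne_top⟩)
    · exact ENNReal.rpow_ne_top_of_ne_zero (prime_ne_zero p) (prime_ne_top p)
    · exact ENNReal.rpow_ne_top_of_nonneg (by positivity) hA
  have h2L : (2 : ℝ≥0∞) ^ L ≠ ∞ := ENNReal.rpow_ne_top_of_nonneg hL0 (by simp)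
  refine ⟨2 ^ L * (D * Ms + E), ENNReal.mul_ne_top h2L
    (ENNReal.add_ne_top.2 ⟨ENNReal.mul_ne_top hD hMs, hEt⟩), fun F hF hF1 => ?_⟩
  have hm : MeasurableSet {y | 1 ≤ F y} := measurableSet_le measurable_const hF
  set F₁ := {y | 1 ≤ F y}.indicator F with hF₁d
  set F₂ := {y | 1 ≤ F y}ᶜ.indicator F with hF₂d
  have hF₁ : Measurable F₁ := hF.indicator hm
  have hF₂ : Measurable F₂ := hF.indicator hm.compl
  have hadd : ∀ y, F y = F₁ y + F₂ y := fun y =>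
    (congrFun (Set.indicator_self_add_compl {y | 1 ≤ F y} F) y).symm
  have hle₁ : ∀ y, F₁ y ≤ F y := fun y => by rw [hadd y]; exact le_self_add
  have hle₂ : ∀ y, F₂ y ≤ F y := fun y => by rw [hadd y]; exact le_add_self
  have hI₁ : ∫⁻ y, F₁ y ^ r y ∂haar p n ≤ 1 := (lintegral_mono fun y =>
    ENNReal.rpow_le_rpow (hle₁ y) (by linarith [hr.isExponent.one_lt y])).trans hF1
  have hI₂ : ∫⁻ y, F₂ y ^ r y ∂haar p n ≤ 1 := (lintegral_mono fun y =>
    ENNReal.rpow_le_rpow (hle₂ y) (by linarith [hr.isExponent.one_lt y])).trans hF1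
  have h01 : ∀ y, F₁ y = 0 ∨ 1 ≤ F₁ y := by
    intro y
    by_cases hy : 1 ≤ F y
    · right; rwa [hF₁d, Set.indicator_of_mem (show y ∈ {y | 1 ≤ F y} from hy)]
    · left; exact Set.indicator_of_notMem (show y ∉ {y | 1 ≤ F y} from hy) _
  have h21 : ∀ y, F₂ y ≤ 1 := by
    intro y
    by_cases hy : 1 ≤ F y
    · rw [hF₂d, Set.indicator_of_notMem (show y ∉ {y | 1 ≤ F y}ᶜ from fun h => h hy)]
      exact zero_le_one
    · exact (hle₂ y).trans (not_le.1 hy).le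
  obtain ⟨hH2, hHR⟩ := hreg F₁ F₂ hF₁ hF₂ h01 h21 hI₁ hI₂
  -- Averaging over unit balls tames the unbounded part, and balls of radius at least 1 cannot tell
  -- `H` from `F`.
  set H : Space p n → ℝ≥0∞ := fun y => avg F₁ 0 y + F₂ y with hH
  have hHm : Measurable H := (measurable_avg F₁ 0).add hF₂
  set Φ : Space p n → ℝ≥0∞ := fun y => F₁ y ^ (r y / s) with hΦ
  have hΦm : Measurable Φ := hF₁.pow (hr.isExponent.measurable.div_const s)
  have hHK : ∀ x, fracMax α H x ≤ K := fracMax_le_max hHm.aemeasurable hα hR.le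
    (by have : 0 < 1 / Q := by positivity
        linarith) hHR hH2
  have hHQ : ∫⁻ x, fracMax α H x ^ Q ∂haar p n ≤ A ^ (α * Q) * (MR * A) := by
    calc ∫⁻ x, fracMax α H x ^ Q ∂haar p n
        ≤ ∫⁻ x, A ^ (α * Q) * maxFn H x ^ R ∂haar p n := lintegral_mono fun x =>
          fracMax_rpow_le hHm.aemeasurable hα hR.le hQ0 hRQ hHR x
      _ = A ^ (α * Q) * ∫⁻ x, maxFn H x ^ R ∂haar p n :=
          lintegral_const_mul _ ((measurable_maxFn H).pow_const R)
      _ ≤ _ := by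
          gcongr
          exact (hmaxR H hHm).trans (by gcongr)
  have hHq : ∫⁻ x, fracMax α H x ^ q x ∂haar p n ≤ E := by
    refine (lintegral_rpow_le_of_decay hc.le (t := fun _ => Q)
      (fun x => (hq.isExponent.one_lt x).le) hqL (fun _ => hQ0.le) hqQ hK1 hKt hHK).trans ?_
    rw [hE]; gcongr
  have hpt : ∀ᵐ x ∂haar p n, fracMax α F x ^ q x ≤
      2 ^ L * (D * maxFn Φ x ^ s + fracMax α H x ^ q x) := by
    filter_upwards [hsmall F₁ hF₁ h01 hI₁] with x hx
    have hq0 : 0 < q x := by linarith [hq.isExponent.one_lt x]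
    have hsplit : fracMax α F x ≤ (D * maxFn Φ x ^ s) ^ (q x)⁻¹ + fracMax α H x := by
      refine iSup_le fun γ => ?_
      have havg : avg F γ x = avg F₁ γ x + avg F₂ γ x := by
        rw [← avg_add hF₁.aemeasurable, funext hadd]
      rw [havg, mul_add]
      -- On small balls `F₁` is handled by the frozen exponent estimate and `F₂ ≤ H`; on large balls
      -- `F` and `H` have the same average.
      rcases le_total γ 0 with hγ | hγ
      · gcongr
        · exact (ENNReal.le_rpow_inv_iff hq0).2 (hx γ hγ)
        · refine le_trans ?_ (le_fracMax α H γ x)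
          gcongr
          exact avg_mono (fun y => le_add_self) γ x
      · refine le_trans ?_ le_add_self
        refine le_trans ?_ (le_fracMax α H γ x)
        rw [← mul_add, hH, avg_add (measurable_avg F₁ 0).aemeasurable,
          avg_avg hF₁.aemeasurable hγ]
    calc fracMax α F x ^ q x ≤ ((D * maxFn Φ x ^ s) ^ (q x)⁻¹ + fracMax α H x) ^ q x := by gcongr
      _ ≤ 2 ^ q x * (((D * maxFn Φ x ^ s) ^ (q x)⁻¹) ^ q x + fracMax α H x ^ q x) :=
          add_rpow_le hq0.le
      _ ≤ _ := by
          rw [ENNReal.rpow_inv_rpow hq0.ne']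
          gcongr
          · norm_num
          · exact hqL x
  have hΦs : ∀ y, Φ y ^ s = F₁ y ^ r y := fun y => by
    rw [hΦ, ← ENNReal.rpow_mul, div_mul_cancel₀ _ (by linarith : s ≠ 0)]
  calc ∫⁻ x, fracMax α F x ^ q x ∂haar p n
      ≤ ∫⁻ x, 2 ^ L * (D * maxFn Φ x ^ s + fracMax α H x ^ q x) ∂haar p n := lintegral_mono_ae hpt
    _ = 2 ^ L * (D * ∫⁻ x, maxFn Φ x ^ s ∂haar p n + ∫⁻ x, fracMax α H x ^ q x ∂haar p n) := by
        rw [lintegral_const_mul' _ _ h2L,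
          lintegral_add_left (((measurable_maxFn Φ).pow_const s).const_mul D),
          lintegral_const_mul' _ _ hD]
    _ ≤ 2 ^ L * (D * (Ms * 1) + E) := by
        gcongr
        refine (hmaxs Φ hΦm).trans ?_
        simp_rw [hΦs]
        gcongr
    _ = _ := by rw [mul_one]

/-! ### Luxemburg norms of nonnegative functions -/

/-- The Luxemburg norm of a nonnegative function. -/
def luxEnn (q : Space p n → ℝ) (F : Space p n → ℝ≥0∞) : ℝ≥0∞ :=
  ⨅ (η : ℝ≥0) (_ : 0 < η ∧ ∫⁻ x, (F x / η) ^ q x ∂haar p n ≤ 1), (η : ℝ≥0∞)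

lemma luxNorm_eq (q : Space p n → ℝ) (f : Space p n → EReal) :
    luxNorm q f = luxEnn q fun x => (f x).abs := rfl

lemma luxEnn_le {q : Space p n → ℝ} {F : Space p n → ℝ≥0∞} {η : ℝ≥0} (hη : 0 < η)
    (h : ∫⁻ x, (F x / η) ^ q x ∂haar p n ≤ 1) : luxEnn q F ≤ η :=
  iInf₂_le η ⟨hη, h⟩

lemma luxEnn_mono {q : Space p n → ℝ} (hq : ∀ x, 0 ≤ q x) {F G : Space p n → ℝ≥0∞}
    (h : ∀ᵐ x ∂haar p n, F x ≤ G x) : luxEnn q F ≤ luxEnn q G := by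
  refine le_iInf₂ fun η hη => luxEnn_le hη.1 (le_trans (lintegral_mono_ae ?_) hη.2)
  filter_upwards [h] with x hx
  have := hq x
  gcongr

/-- Reduces a norm inequality to the scales `η` admissible for `G`; positivity of `c` keeps the
product meaningful when there are none and the infimum is `∞`. -/
lemma luxEnn_le_mul_of_forall {q r : Space p n → ℝ} {F G : Space p n → ℝ≥0∞} {c : ℝ≥0}
    (hc : 0 < c)
    (h : ∀ η : ℝ≥0, 0 < η → ∫⁻ x, (G x / η) ^ r x ∂haar p n ≤ 1 → luxEnn q F ≤ c * η) :
    luxEnn q F ≤ c * luxEnn r G := by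
  have hc0 : (c : ℝ≥0∞) ≠ 0 := by simpa using hc.ne'
  simp only [luxEnn]
  rw [ENNReal.mul_iInf_of_ne hc0 (by simp)]
  refine le_iInf fun η => ?_
  rw [ENNReal.mul_iInf_of_ne hc0 (by simp)]
  exact le_iInf fun hη => h η hη.1 hη.2

lemma luxEnn_const_mul_le {q : Space p n → ℝ} (F : Space p n → ℝ≥0∞) {c : ℝ≥0} (hc : 0 < c) :
    luxEnn q (fun x => c * F x) ≤ c * luxEnn q F := by
  refine luxEnn_le_mul_of_forall hc fun η hη h => ?_
  have hc0 : (c : ℝ≥0∞) ≠ 0 := by simpa using hc.ne'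
  rw [← ENNReal.coe_mul]
  refine luxEnn_le (mul_pos hc hη) ?_
  simpa only [ENNReal.coe_mul, ENNReal.mul_div_mul_left _ _ hc0 ENNReal.coe_ne_top] using h

lemma const_mul_luxEnn_le {q : Space p n → ℝ} (F : Space p n → ℝ≥0∞) {c : ℝ≥0} (hc : 0 < c) :
    c * luxEnn q F ≤ luxEnn q (fun x => c * F x) := by
  have hc0 : (c : ℝ≥0∞) ≠ 0 := by simpa using hc.ne'
  have h := luxEnn_const_mul_le (q := q) (fun x => c * F x) (inv_pos.2 hc)
  simp only [← mul_assoc, ENNReal.coe_inv hc.ne',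
    ENNReal.inv_mul_cancel hc0 ENNReal.coe_ne_top, one_mul] at h
  calc c * luxEnn q F ≤ c * ((c : ℝ≥0∞)⁻¹ * luxEnn q (fun x => c * F x)) := by gcongr
    _ = _ := by rw [← mul_assoc, ENNReal.mul_inv_cancel hc0 ENNReal.coe_ne_top, one_mul]

/-- Dividing by a bound of the modular brings a function into the unit ball. -/
lemma lintegral_div_rpow_le_one {q : Space p n → ℝ} (hq : ∀ x, 1 ≤ q x)
    {F : Space p n → ℝ≥0∞} {C : ℝ≥0} (hC : 1 ≤ C)
    (h : ∫⁻ x, F x ^ q x ∂haar p n ≤ C) : ∫⁻ x, (F x / C) ^ q x ∂haar p n ≤ 1 := by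
  have hC0 : (C : ℝ≥0∞) ≠ 0 := by simpa using (one_pos.trans_le hC).ne'
  have hi : (C : ℝ≥0∞)⁻¹ ≤ 1 := ENNReal.inv_le_one.2 (by exact_mod_cast hC)
  calc ∫⁻ x, (F x / C) ^ q x ∂haar p n
      ≤ ∫⁻ x, (C : ℝ≥0∞)⁻¹ * F x ^ q x ∂haar p n := by
        refine lintegral_mono fun x => ?_
        have h0 : 0 ≤ q x := by linarith [hq x]
        simp only
        rw [div_eq_mul_inv, mul_comm, ENNReal.mul_rpow_of_nonneg _ _ h0]
        gcongr
        simpa using ENNReal.rpow_le_rpow_of_exponent_ge hi (hq x)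
    _ = (C : ℝ≥0∞)⁻¹ * ∫⁻ x, F x ^ q x ∂haar p n :=
        lintegral_const_mul' _ _ (ENNReal.inv_ne_top.2 hC0)
    _ ≤ (C : ℝ≥0∞)⁻¹ * C := by gcongr
    _ = 1 := ENNReal.inv_mul_cancel hC0 ENNReal.coe_ne_top

lemma exists_admissible_of_lintegral_ne_top {q : Space p n → ℝ} (hq : ∀ x, 1 ≤ q x)
    {F : Space p n → ℝ≥0∞} {η : ℝ≥0} (hη : 0 < η)
    (h : ∫⁻ x, (F x / η) ^ q x ∂haar p n < ∞) :
    ∃ θ : ℝ≥0, 0 < θ ∧ ∫⁻ x, (F x / θ) ^ q x ∂haar p n ≤ 1 := by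
  obtain ⟨I, hI⟩ := ENNReal.lt_iff_exists_coe.1 h
  have hC : (1 : ℝ≥0) ≤ max 1 I := le_max_left _ _
  refine ⟨η * max 1 I, mul_pos hη (one_pos.trans_le hC), ?_⟩
  have := lintegral_div_rpow_le_one hq hC (F := fun x => F x / η)
    (by rw [hI.1]; exact_mod_cast le_max_right _ _)
  have hη0 : (η : ℝ≥0∞) ≠ 0 := by simpa using hη.ne'
  refine le_of_eq_of_le (lintegral_congr fun x => ?_) this
  rw [ENNReal.coe_mul, div_eq_mul_inv, div_eq_mul_inv, div_eq_mul_inv,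
    ENNReal.mul_inv (.inl hη0) (.inl ENNReal.coe_ne_top), mul_assoc]

/-- Applied to maximal functions, this is what makes the commutator well defined almost everywhere.
-/
lemma ae_lt_top_of_luxEnn_ne_top {q : Space p n → ℝ} (hq : IsExponent q)
    {F : Space p n → ℝ≥0∞} (hF : AEMeasurable F (haar p n)) (h : luxEnn q F ≠ ∞) :
    ∀ᵐ x ∂haar p n, F x < ∞ := by
  obtain ⟨η, hη⟩ := iInf_lt_iff.1 h.lt_top
  obtain ⟨⟨hη0, hη1⟩, -⟩ := iInf_lt_iff.1 hη
  have hm : AEMeasurable (fun x => (F x / η) ^ q x) (haar p n) :=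
    (hF.div_const _).pow hq.measurable.aemeasurable
  filter_upwards [ae_lt_top' hm (hη1.trans_lt ENNReal.one_lt_top).ne] with x hx
  by_contra hx'
  rw [not_lt, top_le_iff] at hx'
  rw [hx', ENNReal.top_div_of_ne_top ENNReal.coe_ne_top,
    ENNReal.top_rpow_of_pos (by linarith [hq.one_lt x])] at hx
  exact lt_irrefl _ hx

/-- The fractional maximal function is bounded between variable exponent spaces. -/
theorem exists_luxEnn_fracMax_le (hn : 1 ≤ n) {r q : Space p n → ℝ} (hr : IsLogHolder r)
    (hq : IsLogHolder q) {α : ℝ} (hα : 0 ≤ α) (h : ∀ x, 1 / q x = 1 / r x - α) :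
    ∃ C : ℝ≥0, 0 < C ∧ ∀ F : Space p n → ℝ≥0∞, AEMeasurable F (haar p n) →
      luxEnn q (fracMax α F) ≤ C * luxEnn r F := by
  obtain ⟨C₀, hC₀, hmod⟩ := exists_lintegral_fracMax_rpow_le hn hr hq hα h
  lift C₀ to ℝ≥0 using hC₀
  have hC : (1 : ℝ≥0) ≤ max 1 C₀ := le_max_left _ _
  have hC0 : 0 < max 1 C₀ := one_pos.trans_le hC
  refine ⟨max 1 C₀, hC0, fun F hF => luxEnn_le_mul_of_forall hC0 fun η hη hadm => ?_⟩
  rw [fracMax_congr_ae hF.ae_eq_mk]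
  set G := hF.mk F with hG
  have hη0 : (η : ℝ≥0∞) ≠ 0 := by simpa using hη.ne'
  have hit : (η : ℝ≥0∞)⁻¹ ≠ ∞ := ENNReal.inv_ne_top.2 hη0
  have h1 : ∫⁻ x, ((η : ℝ≥0∞)⁻¹ * G x) ^ r x ∂haar p n ≤ 1 := by
    refine le_of_eq_of_le (lintegral_congr_ae ?_) hadm
    filter_upwards [hF.ae_eq_mk] with x hx
    rw [hG, ← hx, div_eq_mul_inv, mul_comm]
  have h2 := lintegral_div_rpow_le_one (fun x => (hq.isExponent.one_lt x).le) hC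
    ((hmod _ (hF.measurable_mk.const_mul _) h1).trans (by exact_mod_cast le_max_right _ _))
  rw [← ENNReal.coe_mul]
  refine luxEnn_le (mul_pos hC0 hη) (le_of_eq_of_le (lintegral_congr fun x => ?_) h2)
  rw [fracMax_const_mul hit, ENNReal.coe_mul, mul_comm ((max 1 C₀ : ℝ≥0) : ℝ≥0∞),
    div_eq_mul_inv, div_eq_mul_inv,
    ENNReal.mul_inv (.inl hη0) (.inl ENNReal.coe_ne_top)]
  congr 1; ring

/-! ### Measurability -/

lemma measurable_ereal_abs : Measurable EReal.abs :=
  EReal.measurable_of_measurable_real (by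
    simp only [EReal.abs_def]
    exact (ENNReal.measurable_ofReal.comp measurable_id.abs))

lemma enorm_eq_abs_coe (a : ℝ) : ‖a‖ₑ = (a : EReal).abs := by
  rw [EReal.abs_def, Real.enorm_eq_ofReal_abs]

lemma maximal_eq (f : Space p n → ℝ) : maximal f = maxFn fun y => ‖f y‖ₑ := rfl

lemma avgAbs_eq (f : Space p n → ℝ) : avgAbs f = avg fun y => ‖f y‖ₑ := rfl

lemma aemeasurable_commutator {b : Space p n → ℝ} (hb : AEMeasurable b (haar p n))
    (f : Space p n → ℝ) : AEMeasurable (commutator b f) (haar p n) := by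
  have hneg : Measurable fun x => -(maximal (fun y => b y * f y) x : EReal) :=
    continuous_neg.measurable.comp (measurable_maxFn _).coe_ereal_ennreal
  have := (hb.coe_real_ereal.mul (measurable_maxFn fun y => ‖f y‖ₑ).coe_ereal_ennreal.aemeasurable).add
    hneg.aemeasurable
  exact this

lemma MemVarLp.aemeasurable_of_coe {r f : Space p n → ℝ}
    (h : MemVarLp r fun x => (f x : EReal)) : AEMeasurable f (haar p n) := by
  simpa using h.1.ereal_toReal

/-! ### Lipschitz symbols have bounded commutators -/

lemma MemLip.exists_bound {β : ℝ} (hβ : 0 < β) {b : Space p n → ℝ} (hb : MemLip β b) :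
    ∃ L : ℝ≥0, ∀ x y, |b x - b y| ≤ L * ‖x - y‖ ^ β := by
  refine ⟨(lipNorm β b).toNNReal, fun x y => ?_⟩
  rcases eq_or_ne x y with rfl | hxy
  · simp [hβ.ne']
  have h0 : 0 < ‖x - y‖ ^ β := Real.rpow_pos_of_pos (norm_pos_iff.2 (sub_ne_zero.2 hxy)) β
  have h : ENNReal.ofReal (|b x - b y| / ‖x - y‖ ^ β) ≤ lipNorm β b :=
    le_iSup_of_le x (le_iSup_of_le y (le_iSup_of_le hxy le_rfl))
  rw [← div_le_iff₀ h0]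
  exact (ENNReal.ofReal_le_iff_le_toReal hb.2.ne).1 h

lemma ofReal_radius_rpow (hn : 1 ≤ n) (γ : ℤ) (β : ℝ) :
    ENNReal.ofReal (((p : ℝ) ^ γ) ^ β) = vol p n γ ^ (β / n) := by
  have hn0 : (n : ℝ) ≠ 0 := by positivity
  have hp := prime_real_pos p
  rw [vol_rpow, ← Real.rpow_intCast, ← Real.rpow_mul hp.le, ← ENNReal.ofReal_rpow_of_pos hp,
    ENNReal.ofReal_natCast]
  congr 1; field_simp

lemma abs_coe_sub_coe_le {A B E : ℝ≥0∞} (hA : A ≠ ∞) (hB : B ≠ ∞) (h1 : A ≤ B + E)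
    (h2 : B ≤ A + E) : ((A : EReal) - (B : EReal)).abs ≤ E := by
  rcases eq_or_ne E ∞ with rfl | hE
  · exact le_top
  lift A to ℝ≥0 using hA
  lift B to ℝ≥0 using hB
  lift E to ℝ≥0 using hE
  norm_cast at h1 h2
  have h3 : ((A : ℝ≥0∞) : EReal) - ((B : ℝ≥0∞) : EReal) = (((A : ℝ) - (B : ℝ) : ℝ) : EReal) := rfl
  rw [h3, EReal.abs_def]
  refine ENNReal.ofReal_le_of_le_toReal ?_
  rw [ENNReal.coe_toReal, abs_le]
  have h1' : (A : ℝ) ≤ B + E := by exact_mod_cast h1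
  have h2' : (B : ℝ) ≤ A + E := by exact_mod_cast h2
  constructor <;> linarith

/-- Since `b ≥ 0`, `|b f| = b |f|`, and on each ball `b` may be exchanged for `b x` with error `L
|B| ^ (β / n)`. The two one-sided inequalities become a bound on the difference once both terms are
finite. -/
lemma abs_commutator_le (hn : 1 ≤ n) {β : ℝ} (hβ : 0 < β) {b f : Space p n → ℝ} {L : ℝ≥0}
    (hb0 : ∀ x, 0 ≤ b x) (hb : ∀ x y, |b x - b y| ≤ L * ‖x - y‖ ^ β)
    (hf : AEMeasurable f (haar p n)) {x : Space p n} (hM : maximal f x ≠ ∞)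
    (hMβ : fracMax (β / n) (fun y => ‖f y‖ₑ) x ≠ ∞) :
    (commutator b f x).abs ≤ L * fracMax (β / n) (fun y => ‖f y‖ₑ) x := by
  set F : Space p n → ℝ≥0∞ := fun y => ‖f y‖ₑ with hF
  have hFm : AEMeasurable F (haar p n) := hf.enorm
  set bE : Space p n → ℝ≥0∞ := fun y => ENNReal.ofReal (b y) with hbE
  have hbF : ∀ y, ‖b y * f y‖ₑ = bE y * F y := fun y => by
    rw [enorm_mul, hbE, Real.enorm_eq_ofReal (hb0 y)]
  set T := maximal (fun y => b y * f y) x with hT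
  have hTeq : T = maxFn (fun y => bE y * F y) x := by
    rw [hT, maximal_eq]; simp_rw [hbF]
  set m := fracMax (β / n) F x with hm
  have hosc : ∀ γ : ℤ, ∀ y ∈ pBall γ x, ∀ u v : Space p n, (u = x ∧ v = y ∨ u = y ∧ v = x) →
      bE u ≤ bE v + L * vol p n γ ^ (β / n) := by
    intro γ y hy u v huv
    have hd : ‖u - v‖ ≤ (p : ℝ) ^ γ := by
      rcases huv with ⟨rfl, rfl⟩ | ⟨rfl, rfl⟩
      · simpa [pBall, dist_eq_norm, norm_sub_rev] using hy
      · simpa [pBall, dist_eq_norm] using hy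
    have h1 : b u ≤ b v + L * ((p : ℝ) ^ γ) ^ β := by
      have h2 := (le_abs_self _).trans (hb u v)
      have h3 : ‖u - v‖ ^ β ≤ ((p : ℝ) ^ γ) ^ β := by gcongr
      have h4 := mul_le_mul_of_nonneg_left h3 L.2
      change b u - b v ≤ _ at h2
      linarith [show (L : ℝ) * ‖u - v‖ ^ β ≤ L * ((p : ℝ) ^ γ) ^ β from h4]
    calc bE u ≤ ENNReal.ofReal (b v + L * ((p : ℝ) ^ γ) ^ β) := ENNReal.ofReal_le_ofReal h1
      _ ≤ bE v + ENNReal.ofReal (L * ((p : ℝ) ^ γ) ^ β) := ENNReal.ofReal_add_le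
      _ = _ := by
        rw [ENNReal.ofReal_mul L.coe_nonneg, ofReal_radius_rpow hn, ENNReal.ofReal_coe_nnreal]
  have hvol : ∀ γ, (L : ℝ≥0∞) * vol p n γ ^ (β / n) ≠ ∞ := fun γ =>
    ENNReal.mul_ne_top ENNReal.coe_ne_top
      (ENNReal.rpow_ne_top_of_ne_zero (vol_ne_zero p n γ) (vol_ne_top p n γ))
  have hbt : ∀ y, bE y ≠ ∞ := fun y => ENNReal.ofReal_ne_top
  have hfrac : ∀ γ, (L : ℝ≥0∞) * vol p n γ ^ (β / n) * avg F γ x ≤ L * m := fun γ => by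
    rw [mul_assoc]; gcongr; exact le_fracMax _ F γ x
  have h1 : T ≤ bE x * maximal f x + L * m := by
    rw [hTeq]
    refine iSup_le fun γ => ?_
    calc avg (fun y => bE y * F y) γ x
        ≤ avg (fun y => bE x * F y + L * vol p n γ ^ (β / n) * F y) γ x := by
          refine avg_mono_on (.of_forall fun y hy => ?_)
          rw [← add_mul]
          gcongr
          exact hosc γ y hy y x (.inr ⟨rfl, rfl⟩)
      _ = bE x * avg F γ x + L * vol p n γ ^ (β / n) * avg F γ x := by
          rw [avg_add (hFm.const_mul _), avg_const_mul (hbt x), avg_const_mul (hvol γ)]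
      _ ≤ _ := add_le_add (mul_le_mul_right (avg_le_maxFn F γ x) _) (hfrac γ)
  have h2 : bE x * maximal f x ≤ T + L * m := by
    rw [maximal_eq, maxFn, ENNReal.mul_iSup]
    refine iSup_le fun γ => ?_
    calc bE x * avg F γ x = avg (fun y => bE x * F y) γ x := (avg_const_mul (hbt x) γ x).symm
      -- The summand without `b y` comes first: additivity of averages needs only the first summand
      -- to be measurable.
      _ ≤ avg (fun y => L * vol p n γ ^ (β / n) * F y + bE y * F y) γ x := by
          refine avg_mono_on (.of_forall fun y hy => ?_)
          rw [add_comm, ← add_mul]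
          gcongr
          exact hosc γ y hy x y (.inl ⟨rfl, rfl⟩)
      _ = L * vol p n γ ^ (β / n) * avg F γ x + avg (fun y => bE y * F y) γ x := by
          rw [avg_add (hFm.const_mul _), avg_const_mul (hvol γ)]
      _ ≤ L * m + T := add_le_add (hfrac γ) (hTeq ▸ avg_le_maxFn _ γ x)
      _ = _ := add_comm _ _
  have hA : bE x * maximal f x ≠ ∞ := ENNReal.mul_ne_top (hbt x) hM
  have hT' : T ≠ ∞ := ne_top_of_le_ne_top
    (ENNReal.add_ne_top.2 ⟨hA, ENNReal.mul_ne_top ENNReal.coe_ne_top hMβ⟩) h1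
  have hcomm : commutator b f x = ((bE x * maximal f x : ℝ≥0∞) : EReal) - (T : EReal) := by
    rw [commutator, EReal.coe_ennreal_mul, hbE, EReal.coe_ennreal_ofReal, max_eq_left (hb0 x)]
  rw [hcomm]
  exact abs_coe_sub_coe_le hA hT' h2 h1

/-- The commutator with a nonnegative Lipschitz function is bounded. -/
theorem commutatorBounded_of_memLip (hn : 1 ≤ n) {β : ℝ} (hβ : 0 < β) {b b' : Space p n → ℝ}
    (hbb' : b' =ᵐ[haar p n] b) (hb' : MemLip β b') (hb0 : ∀ x, 0 ≤ b' x) {r q : Space p n → ℝ}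
    (hrq : IsAdmissiblePair β r q) : CommutatorBounded b r q := by
  obtain ⟨L₀, hL₀⟩ := hb'.exists_bound hβ
  -- Scaling of the norm requires a positive constant.
  set L : ℝ≥0 := L₀ + 1 with hLd
  have hL : ∀ x y, |b' x - b' y| ≤ L * ‖x - y‖ ^ β := fun x y => (hL₀ x y).trans (by
    gcongr; rw [hLd]; exact le_self_add)
  have hL0 : 0 < L := by positivity
  obtain ⟨C, hC0, hC⟩ := exists_luxEnn_fracMax_le hn hrq.left hrq.right
    (α := β / n) (by positivity) hrq.eq
  -- The case `α = 0` shows that `M f` is finite almost everywhere, which excludes `∞ - ∞`.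
  obtain ⟨C', -, hC'⟩ := exists_luxEnn_fracMax_le hn hrq.left hrq.left le_rfl
    (fun x => (sub_zero _).symm)
  have hr1 : ∀ x, 1 ≤ r x := fun x => (hrq.left.isExponent.one_lt x).le
  have hq0 : ∀ x, 0 ≤ q x := fun x => by linarith [hrq.right.isExponent.one_lt x]
  refine ⟨L * C, fun f hf => ?_⟩
  have hfm := hf.aemeasurable_of_coe
  have hFm : AEMeasurable (fun y => ‖f y‖ₑ) (haar p n) := hfm.enorm
  have hnorm : luxNorm r (fun x => (f x : EReal)) = luxEnn r fun y => ‖f y‖ₑ := by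
    simp only [luxNorm_eq, enorm_eq_abs_coe]
  have hfin : luxEnn r (fun y => ‖f y‖ₑ) ≠ ∞ := by
    obtain ⟨-, η, hη, hmod⟩ := hf
    obtain ⟨θ, hθ, hθ1⟩ := exists_admissible_of_lintegral_ne_top hr1 hη hmod
    rw [← hnorm]
    exact ne_top_of_le_ne_top ENNReal.coe_ne_top (luxEnn_le hθ hθ1)
  have hMβfin : luxEnn q (fracMax (β / n) fun y => ‖f y‖ₑ) ≠ ∞ :=
    ne_top_of_le_ne_top (ENNReal.mul_ne_top ENNReal.coe_ne_top hfin) (hC _ hFm)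
  have hMfin : luxEnn r (maxFn fun y => ‖f y‖ₑ) ≠ ∞ := by
    have := hC' _ hFm
    rw [fracMax_zero] at this
    exact ne_top_of_le_ne_top (ENNReal.mul_ne_top ENNReal.coe_ne_top hfin) this
  have hpt : ∀ᵐ x ∂haar p n,
      (commutator b f x).abs ≤ L * fracMax (β / n) (fun y => ‖f y‖ₑ) x := by
    filter_upwards [hbb', ae_lt_top_of_luxEnn_ne_top hrq.right.isExponent
        (measurable_fracMax _ _).aemeasurable hMβfin,
      ae_lt_top_of_luxEnn_ne_top hrq.left.isExponent (measurable_maxFn _).aemeasurable hMfin]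
      with x hx h1 h2
    have hcongr : maximal (fun y => b y * f y) = maximal fun y => b' y * f y := by
      rw [maximal_eq, maximal_eq, ← fracMax_zero, ← fracMax_zero]
      refine fracMax_congr_ae ?_ 0
      filter_upwards [hbb'] with y hy
      rw [hy]
    have : commutator b f x = commutator b' f x := by
      rw [commutator, commutator, hcongr, hx]
    rw [this]
    exact abs_commutator_le hn hβ hb0 hL hfm h2.ne h1.ne
  have hle : luxNorm q (commutator b f) ≤ (L * C : ℝ≥0) * luxNorm r (fun x => (f x : EReal)) := by
    rw [luxNorm_eq, hnorm]
    calc luxEnn q (fun x => (commutator b f x).abs)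
        ≤ luxEnn q (fun x => L * fracMax (β / n) (fun y => ‖f y‖ₑ) x) := luxEnn_mono hq0 hpt
      _ ≤ L * luxEnn q (fracMax (β / n) fun y => ‖f y‖ₑ) := luxEnn_const_mul_le _ hL0
      _ ≤ L * (C * luxEnn r fun y => ‖f y‖ₑ) := by gcongr; exact hC _ hFm
      _ = _ := by rw [← mul_assoc, ENNReal.coe_mul]
  have hbm : AEMeasurable b (haar p n) := hb'.1.aemeasurable.congr hbb'
  refine ⟨⟨aemeasurable_commutator hbm f, ?_⟩, hle⟩
  have hlt : luxNorm q (commutator b f) < ∞ := hle.trans_lt (by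
    rw [hnorm]; exact (ENNReal.mul_ne_top ENNReal.coe_ne_top hfin).lt_top)
  obtain ⟨η, hη⟩ := iInf_lt_iff.1 hlt
  obtain ⟨⟨hη0, hη1⟩, -⟩ := iInf_lt_iff.1 hη
  exact ⟨η, hη0, hη1.trans_lt ENNReal.one_lt_top⟩

/-! ### Characteristic functions of balls -/

/-- The characteristic function of a ball, with values in `[0, ∞]`. -/
def ballFn (γ : ℤ) (x : Space p n) : Space p n → ℝ≥0∞ := (pBall γ x).indicator 1

lemma lintegral_ballFn_div_rpow {q : Space p n → ℝ} (hq : ∀ x, 0 < q x) (γ : ℤ) (x : Space p n)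
    (c : ℝ≥0∞) : ∫⁻ y, (ballFn γ x y / c) ^ q y ∂haar p n =
      ∫⁻ y in pBall γ x, c⁻¹ ^ q y ∂haar p n := by
  rw [← lintegral_indicator (measurableSet_pBall γ x)]
  refine lintegral_congr fun y => ?_
  by_cases hy : y ∈ pBall γ x
  · simp [ballFn, hy]
  · simp [ballFn, hy, hq y]

lemma luxEnn_ballFn_ne_top {q : Space p n → ℝ} (hq : ∀ x, 1 ≤ q x) (γ : ℤ) (x : Space p n) :
    luxEnn q (ballFn γ x) ≠ ∞ := by
  have h : ∫⁻ y, (ballFn γ x y / (1 : ℝ≥0)) ^ q y ∂haar p n < ∞ := by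
    rw [lintegral_ballFn_div_rpow (fun y => by linarith [hq y])]
    simp [haar_pBall_eq_vol, (vol_ne_top p n γ).lt_top]
  obtain ⟨θ, h1, h2⟩ := exists_admissible_of_lintegral_ne_top hq one_pos h
  exact ne_top_of_le_ne_top ENNReal.coe_ne_top (luxEnn_le h1 h2)

/-- An admissible `η < 1` satisfies `|B| / η ≤ 1`, because `q ≥ 1`; so every admissible `η` is at
least `min 1 |B|`. -/
lemma luxEnn_ballFn_ne_zero {q : Space p n → ℝ} (hq : ∀ x, 1 ≤ q x) (γ : ℤ) (x : Space p n) :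
    luxEnn q (ballFn γ x) ≠ 0 := by
  have hV := vol_ne_zero p n γ
  have hpos : 0 < min 1 (vol p n γ) := lt_min one_pos (pos_iff_ne_zero.2 hV)
  refine (hpos.trans_le (le_iInf₂ fun η hη => ?_)).ne'
  by_contra! hlt
  rw [lt_min_iff] at hlt
  have hη0 : (η : ℝ≥0∞) ≠ 0 := by simpa using hη.1.ne'
  have h1 := hη.2
  rw [lintegral_ballFn_div_rpow (fun y => by linarith [hq y])] at h1
  have h2 : (η : ℝ≥0∞)⁻¹ * vol p n γ ≤ 1 := by
    refine le_trans ?_ h1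
    rw [← haar_pBall_eq_vol γ x, ← setLIntegral_const]
    refine lintegral_mono fun y => ?_
    simpa using ENNReal.rpow_le_rpow_of_exponent_le (ENNReal.one_le_inv.2 hlt.1.le) (hq y)
  rw [mul_comm, ← div_eq_mul_inv, ENNReal.div_le_iff hη0 ENNReal.coe_ne_top, one_mul] at h2
  exact absurd hlt.2 (not_lt.2 h2)

/-- Hölder's inequality for characteristic functions of balls. -/
lemma luxEnn_ballFn_le {r q : Space p n → ℝ} {α : ℝ} (hα : 0 < α) (hr : ∀ x, 1 ≤ r x)
    (hq : ∀ x, 1 ≤ q x) (h : ∀ x, 1 / q x = 1 / r x - α) (γ : ℤ) (x : Space p n) :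
    luxEnn r (ballFn γ x) ≤ 2 * vol p n γ ^ α * luxEnn q (ballFn γ x) := by
  have hV := vol_ne_zero p n γ
  have hV' := vol_ne_top p n γ
  obtain ⟨μ, hμ⟩ : ∃ μ : ℝ≥0, vol p n γ ^ α = μ :=
    ⟨_, (ENNReal.coe_toNNReal (ENNReal.rpow_ne_top_of_ne_zero hV hV')).symm⟩
  have hμ0 : 0 < μ := by
    have := ENNReal.rpow_pos (p := α) (pos_iff_ne_zero.2 hV) hV'
    rw [hμ] at this
    exact_mod_cast this
  have hμ0' : (μ : ℝ≥0∞) ≠ 0 := by simpa using hμ0.ne'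
  rw [hμ]
  have hc : 0 < 2 * μ := by positivity
  have key := luxEnn_le_mul_of_forall (q := r) (r := q) (F := ballFn γ x) (G := ballFn γ x) hc
    fun η hη hadm => ?_
  · simpa [ENNReal.coe_mul] using key
  have hη0' : (η : ℝ≥0∞) ≠ 0 := by simpa using hη.ne'
  rw [lintegral_ballFn_div_rpow (fun y => by linarith [hq y])] at hadm
  -- As `r / q + α r = 1`, a Young-type inequality bounds the integrand by `|B|⁻¹ + η ^ (-q)`. Each
  -- term has integral at most 1, whence the factor 2.
  have h1 : ∫⁻ y, (ballFn γ x y / (μ * η : ℝ≥0)) ^ r y ∂haar p n ≤ (2 : ℝ≥0) := by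
    rw [lintegral_ballFn_div_rpow (fun y => by linarith [hr y])]
    calc ∫⁻ y in pBall γ x, ((μ * η : ℝ≥0) : ℝ≥0∞)⁻¹ ^ r y ∂haar p n
        ≤ ∫⁻ y in pBall γ x, ((vol p n γ)⁻¹ + (η : ℝ≥0∞)⁻¹ ^ q y) ∂haar p n := by
          refine lintegral_mono fun y => ?_
          have hr0 : 0 < r y := by linarith [hr y]
          have hq0 : 0 < q y := by linarith [hq y]
          have he : r y / q y + α * r y = 1 := by
            have : r y / q y = r y * (1 / q y) := by ring
            rw [this, h y]; field_simp; ring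
          simp only
          set c := (vol p n γ)⁻¹ with hcd
          set a := (η : ℝ≥0∞)⁻¹ ^ q y with had
          calc ((μ * η : ℝ≥0) : ℝ≥0∞)⁻¹ ^ r y = c ^ (α * r y) * a ^ (r y / q y) := by
                rw [ENNReal.coe_mul, ENNReal.mul_inv (.inl hμ0') (.inl ENNReal.coe_ne_top),
                  ENNReal.mul_rpow_of_nonneg _ _ hr0.le, ← hμ, hcd, had, ← ENNReal.rpow_mul,
                  mul_div_cancel₀ _ hq0.ne', ← ENNReal.inv_rpow, ← ENNReal.rpow_mul]
            _ ≤ max c a ^ (α * r y) * max c a ^ (r y / q y) := by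
                gcongr <;> simp
            _ = max c a := by
                rw [← ENNReal.rpow_add_of_nonneg _ _ (by positivity) (by positivity), add_comm, he,
                  ENNReal.rpow_one]
            _ ≤ c + a := max_le le_self_add le_add_self
      _ = 1 + ∫⁻ y in pBall γ x, (η : ℝ≥0∞)⁻¹ ^ q y ∂haar p n := by
          rw [lintegral_add_left measurable_const, setLIntegral_const, haar_pBall_eq_vol,
            ENNReal.inv_mul_cancel hV hV']
      _ ≤ 1 + 1 := by gcongr
      _ = _ := by norm_num
  have h2 := lintegral_div_rpow_le_one hr (C := 2) one_le_two h1
  rw [← ENNReal.coe_mul]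
  refine luxEnn_le (by positivity) (le_of_eq_of_le (lintegral_congr fun y => ?_) h2)
  have hμη : ((μ * η : ℝ≥0) : ℝ≥0∞) ≠ 0 := by
    rw [ENNReal.coe_mul]; exact mul_ne_zero hμ0' hη0'
  rw [mul_assoc, ENNReal.coe_mul 2, mul_comm ((2 : ℝ≥0) : ℝ≥0∞), div_eq_mul_inv, div_eq_mul_inv,
    div_eq_mul_inv, ENNReal.mul_inv (.inl hμη) (.inl ENNReal.coe_ne_top), mul_assoc]

/-! ### The commutator on characteristic functions -/

/-- The real characteristic function of a ball. -/
def realBallFn (γ : ℤ) (x : Space p n) : Space p n → ℝ := (pBall γ x).indicator 1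

lemma enorm_realBallFn (γ : ℤ) (x y : Space p n) : ‖realBallFn γ x y‖ₑ = ballFn γ x y := by
  by_cases hy : y ∈ pBall γ x <;> simp [realBallFn, ballFn, hy]

lemma avg_ballFn_mul_eq {F : Space p n → ℝ≥0∞} {γ δ : ℤ} {x y : Space p n}
    (h : pBall δ y ⊆ pBall γ x) : avg (fun z => ballFn γ x z * F z) δ y = avg F δ y :=
  (avg_mono_on (.of_forall fun z hz => by simp [ballFn, h hz])).antisymm
    (avg_mono_on (.of_forall fun z hz => by simp [ballFn, h hz]))

/-- Enlarging the ball beyond the support can only increase the denominator. -/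
lemma avg_ballFn_mul_le {F : Space p n → ℝ≥0∞} {γ δ : ℤ} (h : γ ≤ δ) {x y : Space p n}
    (hy : y ∈ pBall γ x) : avg (fun z => ballFn γ x z * F z) δ y ≤ avg F γ y := by
  rw [avg_eq, avg_eq]
  gcongr 1
  · exact ENNReal.inv_le_inv.2 (vol_mono p n h)
  · have : ∀ z, ballFn γ x z * F z = (pBall γ x).indicator F z := fun z => by
      by_cases hz : z ∈ pBall γ x <;> simp [ballFn, hz]
    simp_rw [this]
    rw [← pBall_eq_of_mem hy, ← lintegral_indicator (measurableSet_pBall γ x)]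
    exact setLIntegral_le_lintegral _ _

/-- A ball centred in `B` lies inside `B` or contains it, and in the second case the average over
`B` itself is at least as large. -/
lemma maxFn_ballFn_mul {F : Space p n → ℝ≥0∞} {γ : ℤ} {x y : Space p n} (hy : y ∈ pBall γ x) :
    maxFn (fun z => ballFn γ x z * F z) y =
      ⨆ (δ : ℤ) (_ : pBall δ y ⊆ pBall γ x), avg F δ y := by
  apply le_antisymm
  · refine iSup_le fun δ => ?_
    rcases le_total δ γ with h | h
    · have hs := pBall_subset_of_mem h hy
      rw [avg_ballFn_mul_eq hs]
      exact le_iSup₂ (f := fun δ (_ : pBall δ y ⊆ pBall γ x) => avg F δ y) δ hs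
    · exact (avg_ballFn_mul_le h hy).trans (le_iSup₂
        (f := fun δ (_ : pBall δ y ⊆ pBall γ x) => avg F δ y) γ (pBall_subset_of_mem le_rfl hy))
  · refine iSup₂_le fun δ hδ => ?_
    rw [← avg_ballFn_mul_eq hδ]
    exact avg_le_maxFn _ δ y

lemma maximalIn_eq (b : Space p n → ℝ) {γ : ℤ} {x y : Space p n} (hy : y ∈ pBall γ x) :
    maximalIn (pBall γ x) b y = maximal (fun z => b z * realBallFn γ x z) y := by
  have : (fun z => ‖b z * realBallFn γ x z‖ₑ) = fun z => ballFn γ x z * ‖b z‖ₑ := by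
    ext z; rw [enorm_mul, enorm_realBallFn, mul_comm]
  rw [maximal_eq, this, maxFn_ballFn_mul hy]
  rfl

lemma maximal_realBallFn {γ : ℤ} {x y : Space p n} (hy : y ∈ pBall γ x) :
    maximal (realBallFn γ x) y = 1 := by
  rw [maximal_eq]
  simp_rw [enorm_realBallFn]
  apply le_antisymm
  · refine iSup_le fun δ => avg_le_of_le (.of_forall fun z _ => ?_)
    by_cases hz : z ∈ pBall γ x <;> simp [ballFn, hz]
  · refine le_trans ?_ (avg_le_maxFn _ γ y)
    rw [← avg_const (1 : ℝ≥0∞) γ y]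
    refine avg_mono_on (.of_forall fun z hz => ?_)
    rw [← pBall_eq_of_mem hy] at hz
    simp [ballFn, hz]

lemma commutator_realBallFn (b : Space p n → ℝ) {γ : ℤ} {x y : Space p n} (hy : y ∈ pBall γ x) :
    commutator b (realBallFn γ x) y = (b y : EReal) - (maximalIn (pBall γ x) b y : EReal) := by
  rw [commutator, maximal_realBallFn hy, maximalIn_eq b hy]; simp

lemma abs_indicator_one (γ : ℤ) (x : Space p n) :
    (fun y => ((pBall γ x).indicator (fun _ => (1 : EReal)) y).abs) = ballFn γ x := by
  ext y
  have h1 : (1 : EReal).abs = 1 := by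
    rw [← EReal.coe_one, EReal.abs_def]; simp
  by_cases hy : y ∈ pBall γ x <;> simp [ballFn, hy, h1]

/-- Boundedness of the commutator controls the oscillation. -/
theorem oscillation_lt_top (hn : 1 ≤ n) {β : ℝ} (hβ : 0 < β) {b r q : Space p n → ℝ}
    (hrq : IsAdmissiblePair β r q) (hb : CommutatorBounded b r q) : oscillation β b q < ∞ := by
  obtain ⟨C, hC⟩ := hb
  have hr1 : ∀ x, 1 ≤ r x := fun x => (hrq.left.isExponent.one_lt x).le
  have hq1 : ∀ x, 1 ≤ q x := fun x => (hrq.right.isExponent.one_lt x).le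
  have hα : 0 < β / n := by positivity
  refine lt_of_le_of_lt (b := (C * 2 : ℝ≥0∞)) (iSup₂_le fun γ x => ?_)
    (ENNReal.mul_ne_top ENNReal.coe_ne_top (by simp)).lt_top
  have hV : vol p n γ ^ (β / n) ≠ 0 :=
    (ENNReal.rpow_pos (pos_iff_ne_zero.2 (vol_ne_zero p n γ)) (vol_ne_top p n γ)).ne'
  have hV' : vol p n γ ^ (β / n) ≠ ∞ :=
    ENNReal.rpow_ne_top_of_ne_zero (vol_ne_zero p n γ) (vol_ne_top p n γ)
  have hnorm : (fun y => ((realBallFn γ x y : ℝ) : EReal).abs) = ballFn γ x := by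
    ext y; rw [← enorm_eq_abs_coe, enorm_realBallFn]
  have hmem : MemVarLp r fun y => (realBallFn γ x y : EReal) := by
    refine ⟨(measurable_one.indicator (measurableSet_pBall γ x)).coe_real_ereal.aemeasurable,
      1, one_pos, ?_⟩
    change ∫⁻ y, (((realBallFn γ x y : ℝ) : EReal).abs / (1 : ℝ≥0)) ^ r y ∂haar p n < ∞
    simp_rw [congrFun hnorm]
    rw [lintegral_ballFn_div_rpow (fun y => by linarith [hr1 y])]
    simp [haar_pBall_eq_vol, (vol_ne_top p n γ).lt_top]
  have h1 := (hC _ hmem).2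
  rw [luxNorm_eq, luxNorm_eq, hnorm] at h1
  rw [haar_pBall_eq_vol, luxNorm_eq, luxNorm_eq, abs_indicator_one]
  have h2 : luxEnn q (fun y => ((pBall γ x).indicator
      (fun y => (b y : EReal) - (maximalIn (pBall γ x) b y : EReal)) y).abs) ≤
      C * (2 * vol p n γ ^ (β / n) * luxEnn q (ballFn γ x)) := by
    refine (luxEnn_mono (fun y => by linarith [hq1 y]) (.of_forall fun y => ?_)).trans
      (h1.trans (by gcongr; exact luxEnn_ballFn_le hα hr1 hq1 hrq.eq γ x))
    by_cases hy : y ∈ pBall γ x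
    · rw [Set.indicator_of_mem hy, commutator_realBallFn b hy]
    · simp [hy]
  calc _ ≤ 1 / vol p n γ ^ (β / n) * (C * 2 * vol p n γ ^ (β / n)) := by
        gcongr
        exact ENNReal.div_le_of_le_mul (h2.trans_eq (by ring))
    _ = (C * 2) * (vol p n γ ^ (β / n) * (vol p n γ ^ (β / n))⁻¹) := by rw [one_div]; ring
    _ = C * 2 := by rw [ENNReal.mul_inv_cancel hV hV', mul_one]

/-! ### Bounded oscillation implies the Lipschitz property -/

/-- A bound for the oscillation gives a bound for the means of `|b - M_B b|` over all balls `B`. -/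
lemma exists_avg_abs_sub_maximalIn_le (hn : 1 ≤ n) {β : ℝ} {b q : Space p n → ℝ}
    (hq : IsLogHolder q) (hb : AEMeasurable b (haar p n)) (hosc : oscillation β b q < ∞) :
    ∃ K : ℝ≥0, ∀ (γ : ℤ) (x : Space p n),
      avg (fun y => ((b y : EReal) - (maximalIn (pBall γ x) b y : EReal)).abs) γ x ≤
        K * vol p n γ ^ (β / n) := by
  obtain ⟨C, hC0, hC⟩ := exists_luxEnn_fracMax_le hn hq hq le_rfl (fun x => (sub_zero _).symm)
  have hq1 : ∀ x, 1 ≤ q x := fun x => (hq.isExponent.one_lt x).le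
  refine ⟨C * (oscillation β b q).toNNReal, fun γ x => ?_⟩
  rw [ENNReal.coe_mul, ENNReal.coe_toNNReal hosc.ne]
  have hV : vol p n γ ^ (β / n) ≠ 0 :=
    (ENNReal.rpow_pos (pos_iff_ne_zero.2 (vol_ne_zero p n γ)) (vol_ne_top p n γ)).ne'
  have hV' : vol p n γ ^ (β / n) ≠ ∞ :=
    ENNReal.rpow_ne_top_of_ne_zero (vol_ne_zero p n γ) (vol_ne_top p n γ)
  have hχ0 := luxEnn_ballFn_ne_zero hq1 γ x
  have hχt := luxEnn_ballFn_ne_top hq1 γ x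
  set G : Space p n → ℝ≥0∞ := fun y => ((pBall γ x).indicator
    (fun y => (b y : EReal) - (maximalIn (pBall γ x) b y : EReal)) y).abs with hG
  have hGm : AEMeasurable G (haar p n) := by
    -- Measurability of `M_B b` on `B` is inherited from the commutator.
    have : G = (pBall γ x).indicator fun y => (commutator b (realBallFn γ x) y).abs := by
      ext y
      by_cases hy : y ∈ pBall γ x
      · simp [hG, hy, commutator_realBallFn b hy]
      · simp [hG, hy]
    rw [this]
    exact (measurable_ereal_abs.comp_aemeasurable (aemeasurable_commutator hb _)).indicator
      (measurableSet_pBall γ x)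
  have havg : avg (fun y => ((b y : EReal) - (maximalIn (pBall γ x) b y : EReal)).abs) γ x ≤
      avg G γ x := avg_mono_on (.of_forall fun y hy => by simp [hG, hy])
  -- On the ball the average of `G` is a constant below `M G`, so boundedness of `M` compares `c
  -- ‖χ_B‖` with `‖G‖` and no duality is needed. Finite `c` are used since the average might be
  -- infinite.
  refine havg.trans (ENNReal.le_of_forall_nnreal_lt fun c hc => ?_)
  rcases eq_or_ne c 0 with rfl | hc0
  · simp
  have hG1 : luxEnn q G ≤ oscillation β b q * vol p n γ ^ (β / n) * luxEnn q (ballFn γ x) := by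
    have h1 : 1 / haar p n (pBall γ x) ^ (β / n) * (luxNorm q ((pBall γ x).indicator
          fun y => (b y : EReal) - (maximalIn (pBall γ x) b y : EReal)) /
        luxNorm q ((pBall γ x).indicator fun _ => (1 : EReal))) ≤ oscillation β b q :=
      le_iSup₂_of_le γ x le_rfl
    rw [haar_pBall_eq_vol, luxNorm_eq, luxNorm_eq, abs_indicator_one, one_div, mul_comm,
      ← div_eq_mul_inv, ENNReal.div_le_iff hV hV', ENNReal.div_le_iff hχ0 hχt] at h1
    exact h1
  have h2 : c * luxEnn q (ballFn γ x) ≤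
      C * (oscillation β b q * vol p n γ ^ (β / n)) * luxEnn q (ballFn γ x) := by
    calc c * luxEnn q (ballFn γ x) ≤ luxEnn q (fun y => c * ballFn γ x y) :=
          const_mul_luxEnn_le _ (pos_iff_ne_zero.2 hc0)
      _ ≤ luxEnn q (fracMax 0 G) := by
          refine luxEnn_mono (fun y => by linarith [hq1 y]) (.of_forall fun y => ?_)
          rw [fracMax_zero]
          by_cases hy : y ∈ pBall γ x
          · refine le_trans ?_ (avg_le_maxFn G γ y)
            rw [avg_eq_of_mem G hy]
            simpa [ballFn, hy] using hc.le
          · simp [ballFn, hy]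
      _ ≤ C * luxEnn q G := hC G hGm
      _ ≤ C * (oscillation β b q * vol p n γ ^ (β / n) * luxEnn q (ballFn γ x)) := by gcongr
      _ = _ := by ring
  rw [mul_assoc]
  exact (ENNReal.mul_le_mul_iff_left hχ0 hχt).1 h2

/-- The normalized restriction of the Haar measure to a ball. -/
def ballMeasure (γ : ℤ) (x : Space p n) : Measure (Space p n) :=
  (vol p n γ)⁻¹ • (haar p n).restrict (pBall γ x)

instance instIsProbabilityMeasureBallMeasure (γ : ℤ) (x : Space p n) :
    IsProbabilityMeasure (ballMeasure γ x) := ⟨by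
  simp [ballMeasure, haar_pBall_eq_vol,
    ENNReal.inv_mul_cancel (vol_ne_zero p n γ) (vol_ne_top p n γ)]⟩

lemma lintegral_ballMeasure (F : Space p n → ℝ≥0∞) (γ : ℤ) (x : Space p n) :
    ∫⁻ y, F y ∂ballMeasure γ x = avg F γ x := by
  rw [ballMeasure, lintegral_smul_measure, avg_eq, smul_eq_mul]

lemma ballMeasure_eq_of_mem {γ : ℤ} {x y : Space p n} (h : y ∈ pBall γ x) :
    ballMeasure γ y = ballMeasure γ x := by
  rw [ballMeasure, ballMeasure, pBall_eq_of_mem h]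

lemma integral_ballMeasure (f : Space p n → ℝ) (γ : ℤ) (x : Space p n) :
    ∫ y, f y ∂ballMeasure γ x = ⨍ y in pBall γ x, f y ∂haar p n := by
  rw [average, ballMeasure, Measure.restrict_apply_univ, haar_pBall_eq_vol]

lemma integrable_ballMeasure {b : Space p n → ℝ} (hb : LocallyIntegrable b (haar p n)) (γ : ℤ)
    (x : Space p n) : Integrable b (ballMeasure γ x) :=
  (hb.integrableOn_isCompact (isCompact_closedBall x _)).smul_measure
    (ENNReal.inv_ne_top.2 (vol_ne_zero p n γ))

/-- Compares means at consecutive scales in Campanato's argument. -/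
lemma ballMeasure_sub_one_le (γ : ℤ) (x : Space p n) :
    ballMeasure (γ - 1) x ≤ ((p : ℝ≥0∞) ^ n) • ballMeasure γ x := by
  have hv : (vol p n (γ - 1))⁻¹ = (p : ℝ≥0∞) ^ n * (vol p n γ)⁻¹ := by
    rw [vol, vol, ← ENNReal.rpow_neg, ← ENNReal.rpow_neg, ← ENNReal.rpow_natCast,
      ← ENNReal.rpow_add _ _ (prime_ne_zero p) (prime_ne_top p)]
    congr 1; push_cast; ring
  refine Measure.le_iff.2 fun s _ => ?_
  simp only [ballMeasure, Measure.smul_apply, smul_eq_mul, hv, mul_assoc]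
  gcongr
  exact pBall_mono (by omega) x

/-- If the mean of `(∫ |b| - b)⁺` is small, then `b` is close to its mean and its mean is close
to that of `|b|`. -/
lemma mean_bounds {Ω : Type*} [MeasurableSpace Ω] {ν : Measure Ω} [IsProbabilityMeasure ν]
    {b : Ω → ℝ} (hb : Integrable b ν) {κ : ℝ} (hκ : 0 ≤ κ)
    (h : ∫⁻ y, ENNReal.ofReal ((∫ z, |b z| ∂ν) - b y) ∂ν ≤ ENNReal.ofReal κ) :
    (∫ y, |b y| ∂ν) - ∫ y, b y ∂ν ≤ κ ∧ ∫ y, |b y - ∫ z, b z ∂ν| ∂ν ≤ 2 * κ := by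
  set A := ∫ z, |b z| ∂ν with hA
  set m := ∫ z, b z ∂ν with hm
  have hmA : m ≤ A := integral_mono hb hb.abs fun y => le_abs_self _
  have hAb : Integrable (fun y => A - b y) ν := (integrable_const A).sub hb
  have hmb : Integrable (fun y => m - b y) ν := (integrable_const m).sub hb
  have hpos : ∫ y, max (A - b y) 0 ∂ν ≤ κ := by
    rw [integral_eq_lintegral_of_nonneg_ae (f := fun y => max (A - b y) 0)
      (.of_forall fun y => le_max_right _ _) hAb.pos_part.aestronglyMeasurable]
    refine ENNReal.toReal_le_of_le_ofReal hκ (le_of_eq_of_le (lintegral_congr fun y => ?_) h)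
    rw [ENNReal.ofReal_max, ENNReal.ofReal_zero, max_eq_left zero_le]
  constructor
  · calc A - m = ∫ y, (A - b y) ∂ν := by
          rw [integral_sub (integrable_const A) hb]; simp [hm]
      _ ≤ ∫ y, max (A - b y) 0 ∂ν := integral_mono hAb hAb.pos_part fun y => le_max_left _ _
      _ ≤ κ := hpos
  -- The last term has mean zero, and `m ≤ A` bounds the positive part of `m - b` by that of `A -
  -- b`.
  · have h1 : ∀ y, |b y - m| = 2 * max (m - b y) 0 - (m - b y) := by
      intro y
      rcases le_total (b y) m with hy | hy
      · rw [abs_of_nonpos (by linarith), max_eq_left (by linarith)]; ring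
      · rw [abs_of_nonneg (by linarith), max_eq_right (by linarith)]; ring
    simp_rw [h1]
    rw [integral_sub (hmb.pos_part.const_mul 2) hmb, integral_const_mul,
      integral_sub (integrable_const m) hb]
    have h2 : ∫ y, max (m - b y) 0 ∂ν ≤ ∫ y, max (A - b y) 0 ∂ν :=
      integral_mono hmb.pos_part hAb.pos_part fun y => max_le_max (by linarith) le_rfl
    simp only [integral_const, probReal_univ, one_smul]
    linarith

/-- Used with `m = M_B b` and `u` the mean of `|b|`; for `m = ∞` the right side is `∞`. -/
lemma ofReal_sub_le_abs_sub {a u : ℝ} {m : ℝ≥0∞} (h : ENNReal.ofReal u ≤ m) :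
    ENNReal.ofReal (u - a) ≤ ((a : EReal) - (m : EReal)).abs := by
  rcases eq_or_ne m ∞ with rfl | hm
  · simp
  lift m to ℝ≥0 using hm
  have h3 : (a : EReal) - ((m : ℝ≥0∞) : EReal) = ((a - (m : ℝ) : ℝ) : EReal) := rfl
  rw [h3, EReal.abs_def]
  refine ENNReal.ofReal_le_ofReal ?_
  have h4 : u ≤ m := by
    have := ENNReal.toReal_mono ENNReal.coe_ne_top h
    rw [ENNReal.coe_toReal] at this
    exact (le_max_left u 0).trans (by rwa [ENNReal.toReal_ofReal'] at this)
  rw [abs_sub_comm]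
  exact le_trans (by linarith) (le_abs_self _)

/-- The mean oscillation of `b` over balls, and the difference of the means of `|b|` and `b`. -/
lemma exists_mean_bounds (hn : 1 ≤ n) {β : ℝ} {b q : Space p n → ℝ}
    (hq : IsLogHolder q) (hb : LocallyIntegrable b (haar p n)) (hosc : oscillation β b q < ∞) :
    ∃ K : ℝ, 0 ≤ K ∧ ∀ (γ : ℤ) (x : Space p n),
      (∫ y, |b y| ∂ballMeasure γ x) - ∫ y, b y ∂ballMeasure γ x ≤ K * ((p : ℝ) ^ γ) ^ β ∧
      ∫ y, |b y - ∫ z, b z ∂ballMeasure γ x| ∂ballMeasure γ x ≤ 2 * (K * ((p : ℝ) ^ γ) ^ β) := by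
  obtain ⟨K, hK⟩ := exists_avg_abs_sub_maximalIn_le hn hq hb.aestronglyMeasurable.aemeasurable hosc
  refine ⟨K, K.coe_nonneg, fun γ x => ?_⟩
  have hr : 0 ≤ ((p : ℝ) ^ γ) ^ β := (Real.rpow_pos_of_pos (radius_pos γ) β).le
  have hbi := integrable_ballMeasure hb γ x
  refine mean_bounds hbi (mul_nonneg K.coe_nonneg hr) ?_
  rw [ENNReal.ofReal_mul K.coe_nonneg, ofReal_radius_rpow hn, ENNReal.ofReal_coe_nnreal,
    lintegral_ballMeasure]
  refine le_trans (avg_mono_on (.of_forall fun y hy => ?_)) (hK γ x)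
  refine ofReal_sub_le_abs_sub ?_
  -- The ball itself is one of those in the supremum defining `M_B b`, so `M_B b` is at least the
  -- mean of `|b|`.
  have h1 : ENNReal.ofReal (∫ z, |b z| ∂ballMeasure γ x) = avgAbs b γ y := by
    rw [avgAbs_eq, avg_eq_of_mem _ hy, ← lintegral_ballMeasure,
      ← ofReal_integral_norm_eq_lintegral_enorm hbi]
    rfl
  rw [h1]
  exact le_iSup₂ (f := fun δ (_ : pBall δ y ⊆ pBall γ x) => avgAbs b δ y) γ
    (pBall_subset_of_mem le_rfl hy)

/-- If `p ^ γ ≤ ε < p ^ (γ + 1)`, then `2 ε ≤ p ^ (γ + 2)`, hence the constant `p ^ (2 n)`. Doubling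
gives access to Lebesgue differentiation. -/
instance instIsUnifLocDoublingMeasureHaar : IsUnifLocDoublingMeasure (haar p n) := by
  refine ⟨⟨(p : ℝ≥0) ^ (2 * n), ?_⟩⟩
  filter_upwards [self_mem_nhdsWithin] with ε hε x
  have hp := one_lt_prime_real p
  have hε0 : 0 < ε := hε
  obtain ⟨γ, h1, h2⟩ := exists_mem_Ico_zpow hε0 hp
  have hsub : closedBall x (2 * ε) ⊆ pBall (γ + 2) x := by
    refine closedBall_subset_closedBall ?_
    have h2p : (2 : ℝ) ≤ p := by exact_mod_cast (Fact.out : p.Prime).two_le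
    calc 2 * ε ≤ p * (p : ℝ) ^ (γ + 1) := by gcongr
      _ = (p : ℝ) ^ (γ + 2) := by
        rw [← zpow_one_add₀ (by linarith)]; congr 1; ring
  calc haar p n (closedBall x (2 * ε)) ≤ haar p n (pBall (γ + 2) x) := measure_mono hsub
    _ = ((p : ℝ≥0) ^ (2 * n) : ℝ≥0) * haar p n (pBall γ x) := by
        rw [haar_pBall, haar_pBall]
        push_cast
        rw [← ENNReal.rpow_natCast, ← ENNReal.rpow_add _ _ (prime_ne_zero p) (prime_ne_top p)]
        congr 1; push_cast; ring
    _ ≤ _ := by gcongr; exact closedBall_subset_closedBall h1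

/-- The Lebesgue differentiation theorem along shrinking balls. -/
lemma ae_tendsto_integral_ballMeasure {b : Space p n → ℝ} (hb : LocallyIntegrable b (haar p n)) :
    ∀ᵐ x ∂haar p n, Tendsto (fun k : ℕ => ∫ y, b y ∂ballMeasure (-(k : ℤ)) x) atTop (𝓝 (b x)) := by
  filter_upwards [IsUnifLocDoublingMeasure.ae_tendsto_average (haar p n) hb 1] with x hx
  simp_rw [integral_ballMeasure]
  refine hx (fun _ : ℕ => x) (fun k : ℕ => (p : ℝ) ^ (-(k : ℤ))) ?_ ?_
  · refine tendsto_nhdsWithin_iff.2 ⟨?_, .of_forall fun k => radius_pos _⟩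
    have := tendsto_pow_atTop_nhds_zero_of_lt_one (inv_nonneg.2 (prime_real_pos p).le)
      (inv_lt_one_of_one_lt₀ (one_lt_prime_real p))
    simpa [zpow_neg, inv_pow] using this
  · exact .of_forall fun k => mem_closedBall_self (by rw [one_mul]; exact (radius_pos _).le)

lemma radius_sub_rpow (γ : ℤ) (k : ℕ) (β : ℝ) :
    ((p : ℝ) ^ (γ - k)) ^ β = ((p : ℝ) ^ γ) ^ β * ((p : ℝ) ^ (-β)) ^ k := by
  have hp := prime_real_pos p
  rw [← Real.rpow_intCast, ← Real.rpow_intCast, ← Real.rpow_mul hp.le, ← Real.rpow_mul hp.le,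
    ← Real.rpow_natCast, ← Real.rpow_mul hp.le, ← Real.rpow_add hp]
  congr 1; push_cast; ring

/-- Campanato's argument: means over shrinking balls converge at a geometric rate. -/
lemma exists_limit_of_means {β : ℝ} (hβ : 0 < β) {b : Space p n → ℝ}
    (hb : LocallyIntegrable b (haar p n)) {K : ℝ}
    (h : ∀ (γ : ℤ) (x : Space p n), ∫ y, |b y - ∫ z, b z ∂ballMeasure γ x| ∂ballMeasure γ x ≤
      K * ((p : ℝ) ^ γ) ^ β) :
    ∃ (b' : Space p n → ℝ) (L : ℝ),
      (∀ x, Tendsto (fun k : ℕ => ∫ y, b y ∂ballMeasure (-(k : ℤ)) x) atTop (𝓝 (b' x))) ∧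
      ∀ (γ : ℤ) (x : Space p n), |(∫ y, b y ∂ballMeasure γ x) - b' x| ≤ L * ((p : ℝ) ^ γ) ^ β := by
  have hp := prime_real_pos p
  set ρ : ℝ := (p : ℝ) ^ (-β) with hρ
  have hρ1 : ρ < 1 := Real.rpow_lt_one_of_one_lt_of_neg (one_lt_prime_real p) (by linarith)
  set m : ℤ → Space p n → ℝ := fun γ x => ∫ y, b y ∂ballMeasure γ x with hm
  -- Passing to the next smaller ball costs a factor `p ^ n`, its relative measure; summing over
  -- scales is geometric with ratio `p ^ (-β)`.
  have hstep : ∀ (γ : ℤ) (x : Space p n),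
      |m γ x - m (γ - 1) x| ≤ (p : ℝ) ^ n * (K * ((p : ℝ) ^ γ) ^ β) := by
    intro γ x
    have hint := (integrable_ballMeasure hb γ x).sub (integrable_const (m γ x))
    calc |m γ x - m (γ - 1) x| = |∫ y, (b y - m γ x) ∂ballMeasure (γ - 1) x| := by
          rw [integral_sub (integrable_ballMeasure hb _ x) (integrable_const _), abs_sub_comm]
          simp [hm]
      _ ≤ ∫ y, |b y - m γ x| ∂ballMeasure (γ - 1) x := abs_integral_le_integral_abs
      _ ≤ ∫ y, |b y - m γ x| ∂(((p : ℝ≥0∞) ^ n) • ballMeasure γ x) := by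
          refine integral_mono_measure (ballMeasure_sub_one_le γ x)
            (.of_forall fun y => abs_nonneg _) (hint.abs.smul_measure ?_)
          exact ENNReal.pow_ne_top (prime_ne_top p)
      _ = (p : ℝ) ^ n * ∫ y, |b y - m γ x| ∂ballMeasure γ x := by
          rw [integral_smul_measure]; simp
      _ ≤ _ := by gcongr; exact h γ x
  have hgeom : ∀ (γ : ℤ) (x : Space p n) (k : ℕ),
      dist (m (γ - k) x) (m (γ - (k + 1 : ℕ)) x) ≤ ((p : ℝ) ^ n * (K * ((p : ℝ) ^ γ) ^ β)) * ρ ^ k := by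
    intro γ x k
    have h1 : γ - ((k + 1 : ℕ) : ℤ) = γ - k - 1 := by push_cast; ring
    rw [Real.dist_eq, h1]
    refine (hstep (γ - k) x).trans_eq ?_
    rw [radius_sub_rpow]; ring
  have hex : ∀ x, ∃ l, Tendsto (fun k : ℕ => m (-(k : ℤ)) x) atTop (𝓝 l) := by
    intro x
    have := cauchySeq_tendsto_of_complete (cauchySeq_of_le_geometric ρ _ hρ1 (hgeom 0 x))
    simpa only [zero_sub] using this
  choose b' hb' using hex
  refine ⟨b', (p : ℝ) ^ n * K / (1 - ρ), hb', fun γ x => ?_⟩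
  have hlim : Tendsto (fun k : ℕ => m (γ - k) x) atTop (𝓝 (b' x)) := by
    have hshift : Tendsto (fun k : ℕ => ((k : ℤ) - γ).toNat) atTop atTop := by
      refine tendsto_atTop.2 fun N => ?_
      filter_upwards [eventually_ge_atTop (N + γ.toNat)] with k hk
      omega
    refine ((hb' x).comp hshift).congr' ?_
    filter_upwards [eventually_ge_atTop γ.toNat] with k hk
    simp only [Function.comp]
    congr 1
    omega
  have := dist_le_of_le_geometric_of_tendsto₀ ρ _ hρ1 (hgeom γ x) hlim
  simp only [Nat.cast_zero, sub_zero, Real.dist_eq] at this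
  refine this.trans_eq ?_
  ring

/-- If `p ^ γ < ‖x - y‖ ≤ p ^ (γ + 1)`, both points lie in one ball of radius `p ^ (γ + 1)`, and
both values are close to the same mean. Rounding the radius up costs `p ^ β`. -/
lemma memLip_of_mean_bound {β : ℝ} (hβ : 0 < β) {b b' : Space p n → ℝ}
    (hlim : ∀ x, Tendsto (fun k : ℕ => ∫ y, b y ∂ballMeasure (-(k : ℤ)) x) atTop (𝓝 (b' x)))
    {L : ℝ} (h : ∀ (γ : ℤ) (x : Space p n),
      |(∫ y, b y ∂ballMeasure γ x) - b' x| ≤ L * ((p : ℝ) ^ γ) ^ β) : MemLip β b' := by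
  have hp := prime_real_pos p
  have hL : 0 ≤ L := by
    have h1 := (abs_nonneg _).trans (h 0 0)
    simpa using h1
  refine ⟨measurable_of_tendsto_metrizable (f := fun (k : ℕ) x => ∫ y, b y ∂ballMeasure (-(k : ℤ)) x)
    (fun k => measurable_of_const_on_pBall (-(k : ℤ)) fun x y hy => by
      simp only [ballMeasure_eq_of_mem hy])
    (tendsto_pi_nhds.2 hlim), ?_⟩
  refine lt_of_le_of_lt (b := ENNReal.ofReal (2 * L * (p : ℝ) ^ β)) ?_ ENNReal.ofReal_lt_top
  refine iSup_le fun x => iSup₂_le fun y hxy => ENNReal.ofReal_le_ofReal ?_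
  have h0 : 0 < ‖x - y‖ := norm_pos_iff.2 (sub_ne_zero.2 hxy)
  rw [div_le_iff₀ (Real.rpow_pos_of_pos h0 β)]
  obtain ⟨γ, h1, h2⟩ := exists_mem_Ioc_zpow h0 (one_lt_prime_real p)
  have hmem : y ∈ pBall (γ + 1) x := by
    rw [pBall, mem_closedBall, dist_comm, dist_eq_norm]; exact h2
  have hx := h (γ + 1) x
  have hy := h (γ + 1) y
  rw [ballMeasure_eq_of_mem hmem] at hy
  have hr : ((p : ℝ) ^ (γ + 1)) ^ β ≤ (p : ℝ) ^ β * ‖x - y‖ ^ β := by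
    rw [← Real.mul_rpow hp.le h0.le, zpow_add_one₀ hp.ne', mul_comm]
    gcongr
  calc |b' x - b' y| = |((∫ z, b z ∂ballMeasure (γ + 1) x) - b' y) -
        ((∫ z, b z ∂ballMeasure (γ + 1) x) - b' x)| := by congr 1; ring
    _ ≤ _ := abs_sub _ _
    _ ≤ L * ((p : ℝ) ^ (γ + 1)) ^ β + L * ((p : ℝ) ^ (γ + 1)) ^ β := add_le_add hy hx
    _ = 2 * L * ((p : ℝ) ^ (γ + 1)) ^ β := by ring
    _ ≤ 2 * L * ((p : ℝ) ^ β * ‖x - y‖ ^ β) := by gcongr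
    _ = _ := by ring

/-- Bounded oscillation forces `b` to be a nonnegative Lipschitz function. -/
theorem exists_memLip_of_oscillation_lt_top (hn : 1 ≤ n) {β : ℝ} (hβ : 0 < β)
    {b q : Space p n → ℝ} (hq : IsLogHolder q) (hb : LocallyIntegrable b (haar p n))
    (hosc : oscillation β b q < ∞) :
    ∃ b' : Space p n → ℝ, b' =ᵐ[haar p n] b ∧ MemLip β b' ∧ ∀ x, 0 ≤ b' x := by
  obtain ⟨K, hK, hmean⟩ := exists_mean_bounds hn hq hb hosc
  obtain ⟨b', L, hlim, hL⟩ := exists_limit_of_means hβ hb (K := 2 * K)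
    fun γ x => (hmean γ x).2.trans_eq (by ring)
  have hae := ae_tendsto_integral_ballMeasure hb
  have heq : b' =ᵐ[haar p n] b := by
    filter_upwards [hae] with x hx
    exact tendsto_nhds_unique (hlim x) hx
  have hnonneg : 0 ≤ᵐ[haar p n] b := by
    have habs : LocallyIntegrable (fun y => |b y|) (haar p n) := fun x => (hb x).norm
    filter_upwards [hae, ae_tendsto_integral_ballMeasure habs] with x hx hx'
    have hrad : Tendsto (fun k : ℕ => K * ((p : ℝ) ^ (-(k : ℤ))) ^ β) atTop (𝓝 0) := by
      have hρ1 : (p : ℝ) ^ (-β) < 1 :=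
        Real.rpow_lt_one_of_one_lt_of_neg (one_lt_prime_real p) (by linarith)
      have h1 := (tendsto_pow_atTop_nhds_zero_of_lt_one
        (Real.rpow_nonneg (prime_real_pos p).le _) hρ1).const_mul K
      rw [mul_zero] at h1
      refine h1.congr fun k => ?_
      have := radius_sub_rpow (p := p) 0 k β
      rw [zero_sub] at this
      rw [this]; simp
    -- The gap between the means of `|b|` and `b` vanishes with the radius, so `|b x| - b x ≤ 0`.
    have := le_of_tendsto_of_tendsto' (hx'.sub hx) hrad fun k => (hmean _ x).1
    have h2 := abs_nonneg (b x)
    simp only [Pi.zero_apply]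
    linarith
  refine ⟨b', heq, memLip_of_mean_bound hβ hlim hL, fun x => ?_⟩
  -- Means ignore null sets and converge to `b'` at every point, so the sign holds everywhere.
  refine ge_of_tendsto' (hlim x) fun k => integral_nonneg_of_ae ?_
  exact (Measure.smul_absolutelyContinuous.trans
    Measure.restrict_le_self.absolutelyContinuous).ae_le hnonneg

/-! ### Existence of admissible pairs -/

lemma expInf_const (c : ℝ) {E : Set (Space p n)} (hE : haar p n E ≠ 0) :
    expInf (fun _ => c) E = c :=
  essInf_const _ (by rwa [Ne, Measure.restrict_eq_zero])

lemma expSup_const (c : ℝ) {E : Set (Space p n)} (hE : haar p n E ≠ 0) :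
    expSup (fun _ => c) E = c :=
  essSup_const _ (by rwa [Ne, Measure.restrict_eq_zero])

lemma isLogHolder_const {c : ℝ} (hc : 1 < c) : IsLogHolder (fun _ : Space p n => c) := by
  have hu : haar p n Set.univ ≠ 0 := by
    rw [Ne, Measure.measure_univ_eq_zero]; exact NeZero.ne _
  refine ⟨⟨measurable_const, ?_, fun _ => ?_, fun _ => ?_, |c|, fun _ => le_rfl⟩,
    ⟨1, one_pos, fun γ x => ?_⟩, 1, one_pos, fun x y => ?_⟩
  · rwa [expInf_const c hu]
  · rw [expInf_const c hu]
  · rw [expSup_const c hu]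
  · have hB : haar p n (pBall γ x) ≠ 0 := by rw [haar_pBall_eq_vol]; exact vol_ne_zero p n γ
    rw [expInf_const c hB, expSup_const c hB]; simp
  · rw [sub_self, abs_zero]
    have hp := one_lt_prime_real p
    have : 0 ≤ min ‖x‖ ‖y‖ := le_min (norm_nonneg _) (norm_nonneg _)
    exact div_nonneg zero_le_one (Real.logb_nonneg hp (by linarith))

/-- Constant exponents suffice: `β < 1 ≤ n` leaves room for `1 < c < n / β`. Without such a pair,
"for every" would not imply "for some". -/
lemma exists_isAdmissiblePair (hn : 1 ≤ n) {β : ℝ} (hβ₀ : 0 < β) (hβ₁ : β < 1) :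
    ∃ r q : Space p n → ℝ, IsAdmissiblePair β r q := by
  have hn1 : (1 : ℝ) ≤ n := by exact_mod_cast hn
  have h1 : 1 < n / β := by rw [lt_div_iff₀ hβ₀]; linarith
  obtain ⟨c, hc1, hc2⟩ := exists_between h1
  have hc0 : 0 < c := by linarith
  have hd0 : 0 < 1 / c - β / n := by
    rw [lt_div_iff₀ hβ₀] at hc2
    rw [sub_pos, div_lt_div_iff₀ (by linarith) hc0]
    linarith
  have hd1 : 1 / c - β / n < 1 := by
    have h2 : 1 / c < 1 := (div_lt_one hc0).2 hc1
    have h3 : 0 < β / n := by positivity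
    linarith
  have hu : haar p n Set.univ ≠ 0 := by
    rw [Ne, Measure.measure_univ_eq_zero]; exact NeZero.ne _
  refine ⟨fun _ => c, fun _ => 1 / (1 / c - β / n), isLogHolder_const hc1,
    isLogHolder_const ((one_lt_div hd0).2 hd1), ?_, fun x => one_div_one_div _⟩
  rwa [expSup_const c hu]

end PadicLip

end

/-! ### The equivalence. -/

theorem corollary2 (p : ℕ) [Fact p.Prime] (n : ℕ) (hn : 1 ≤ n) (β : ℝ) (hβ₀ : 0 < β) (hβ₁ : β < 1)
    (b : PadicLip.Space p n → ℝ) (hb : LocallyIntegrable b (PadicLip.haar p n)) :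
    List.TFAE [
      (∃ b' : PadicLip.Space p n → ℝ,
        b' =ᵐ[PadicLip.haar p n] b ∧ PadicLip.MemLip β b' ∧ (∀ x, 0 ≤ b' x)),
      (∀ r q : PadicLip.Space p n → ℝ, PadicLip.IsAdmissiblePair β r q →
        PadicLip.CommutatorBounded b r q),
      (∃ r q : PadicLip.Space p n → ℝ, PadicLip.IsAdmissiblePair β r q ∧
        PadicLip.CommutatorBounded b r q),
      (∃ r q : PadicLip.Space p n → ℝ, PadicLip.IsAdmissiblePair β r q ∧
        PadicLip.oscillation β b q < ∞),
      (∀ r q : PadicLip.Space p n → ℝ, PadicLip.IsAdmissiblePair β r q →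
        PadicLip.oscillation β b q < ∞)] := by
  obtain ⟨r₀, q₀, h₀⟩ := PadicLip.exists_isAdmissiblePair (p := p) hn hβ₀ hβ₁
  tfae_have 1 → 2 := by
    rintro ⟨b', h1, h2, h3⟩ r q hrq
    exact PadicLip.commutatorBounded_of_memLip hn hβ₀ h1 h2 h3 hrq
  tfae_have 2 → 3 := fun h => ⟨r₀, q₀, h₀, h r₀ q₀ h₀⟩
  tfae_have 3 → 4 := by
    rintro ⟨r, q, hrq, h⟩
    exact ⟨r, q, hrq, PadicLip.oscillation_lt_top hn hβ₀ hrq h⟩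
  tfae_have 4 → 1 := by
    rintro ⟨r, q, hrq, h⟩
    exact PadicLip.exists_memLip_of_oscillation_lt_top hn hβ₀ hrq.right hb h
  tfae_have 2 → 5 := fun h r q hrq => PadicLip.oscillation_lt_top hn hβ₀ hrq (h r q hrq)
  tfae_have 5 → 4 := fun h => ⟨r₀, q₀, h₀, h r₀ q₀ h₀⟩
  tfae_finish
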